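/- Let \[g_0(x)=x^{12}-4x^{11}-220x^{10}-88x^9+9768x^8+18480x^7-133760x^6-382272x^5+352880x^4+1664960x^3+455488x^2-994304x+217152\in\mathbb{Q}[x].\] Then $g_0$ is irreducible over $\mathbb{Q}$, its Galois group over $\mathbb{Q}$ is isomorphic to $\mathrm{PGL}_2(11)=\mathrm{PGL}_2(\mathbb{F}_{11})$, and its splitting field in $\mathbb{C}$ is contained in $\mathbb{R}$. Every root field of $g_0$, that is, every number field $K=\mathbb{Q}(a)$ with $g_0(a)=0$, has discriminant $2^{18}\cdot 3^5\cdot 11^{13}\cdot 41^6$. -/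

import Mathlib

open Polynomial

/-- The explicit polynomial of degree 12. -/
noncomputable def g₀ : ℚ[X] :=
  X ^ 12 - 4 * X ^ 11 - 220 * X ^ 10 - 88 * X ^ 9 + 9768 * X ^ 8 + 18480 * X ^ 7
    - 133760 * X ^ 6 - 382272 * X ^ 5 + 352880 * X ^ 4 + 1664960 * X ^ 3
    + 455488 * X ^ 2 - 994304 * X + 217152

/-! Irreducibility. Modulo 5 every root of $g_0$ has Frobenius period exactly 12, so $g_0$ stays
irreducible modulo 5.

Lower bound for the Galois group $G$. Modulo 7 the polynomial has factor degrees 1, 1, 10 and modulo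
29 it has 1, 11. Each Frobenius element fixes a root, and its order is divisible by 10 or 11
respectively. Since $G$ is transitive on twelve roots, $120$ and $132$ divide $|G|$, hence so does
$1320$ (`dvd_card_galois`).

Upper bound. The elements of order six in $\mathrm{PGL}_2(11)$ have 110 six-point orbits on the
projective line, the hexads, which form 55 complementary pairs. As the roots sum to 4, complementary
sets of roots have sums $s$ and $4-s$, so $(s-2)^2$ depends only on the pair; the resolvent of
degree 55 is meant to vanish exactly at the hexads. The roots are labelled through their images in
the 2293-adic integers. At a six-set that is not a hexad the resolvent is nonzero already modulo
$2293^2$. At a hexad its value is divisible by $2293^{21504}$; the product of the distinct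
conjugates of this value is a rational integer, and real bounds on the roots make it smaller than
that power, so it is zero (`hexadValue_eq_zero`, `exists_hexad_numbering`). Hence $G$ preserves the
hexads. Counting hexads through four points recovers the harmonic quadruples, and a permutation that
preserves them and fixes $\infty,0,1$ is trivial. So $G$ embeds in the image of
$\mathrm{PGL}_2(11)$, a group of order at most 1320, and all the inequalities become equalities.

Reality. Twelve sign changes between rational points give twelve real roots.

Discriminant. The powers of an integral generator have discriminant $j^2 d$, where $d$ is the field
discriminant and $j$ the index up to sign. For a root of $g_0$ and for an auxiliary integral
generator $b$ these discriminants are $D i_2^2$ and $D i_1^2$, with $D$ the claimed value and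
$i_1,i_2$ coprime. Coprimality gives $i_1\mid j_1$, so only primes dividing $D$ could spoil $d=D$.
Dedekind's criterion for $b$ at 2, 3, 11 and 41 rules them out (`not_dvd_index_of_dedekindCert`,
`eq_of_sq_mul_eq`). -/

open Polynomial NumberField IsDedekindDomain

/-! ### Computable polynomial arithmetic on coefficient lists -/

namespace ListPoly

/-- Horner evaluation of a list of integer coefficients, lowest degree first. -/
def eval {R : Type*} [CommRing R] (θ : R) : List ℤ → R
  | [] => 0
  | c :: l => c + θ * eval θ l

/-- The polynomial with a given list of coefficients, lowest degree first. -/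
noncomputable def toPoly : List ℤ → ℤ[X]
  | [] => 0
  | c :: l => C c + X * toPoly l

def add : List ℤ → List ℤ → List ℤ
  | [], b => b
  | a, [] => a
  | x :: a, y :: b => (x + y) :: add a b

def scale (c : ℤ) (a : List ℤ) : List ℤ := a.map (c * ·)

def mul : List ℤ → List ℤ → List ℤ
  | [], _ => []
  | x :: a, b => add (scale x b) (0 :: mul a b)

/-- The coefficients of the derivative. -/
def deriv : List ℤ → List ℤ
  | [] => []
  | _ :: l => add l (0 :: deriv l)

def red (m : ℤ) (a : List ℤ) : List ℤ := a.map (· % m)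

/-- Since `c % 0 = c`, the modulus 0 turns this test, and the reductions with it, into exact
arithmetic over the integers. Trailing zeros are ignored. -/
def eqMod (m : ℤ) (a b : List ℤ) : Bool := (add a (scale (-1) b)).all fun c => c % m == 0

/-- One step of reduction modulo the monic polynomial `X ^ n - rem`. -/
def fold (n : ℕ) (rem a : List ℤ) : List ℤ := add (a.take n) (mul (a.drop n) rem)

/-- Multiplication modulo the integer `m` and the monic polynomial `X ^ n - rem`. -/
def mulMod (m : ℤ) (n : ℕ) (rem : List ℤ) : List ℤ → List ℤ → List ℤ
  | [], _ => []
  | x :: a, b => red m (add (scale x b) (fold n rem (0 :: mulMod m n rem a b)))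

def powMod (m : ℤ) (n : ℕ) (rem a : List ℤ) : ℕ → List ℤ
  | 0 => [1]
  | k + 1 => mulMod m n rem a (powMod m n rem a k)

/-- `X ^ (p ^ k)` modulo `p` and the monic polynomial `X ^ n - rem`. -/
def frobIter (p n : ℕ) (rem : List ℤ) : ℕ → List ℤ
  | 0 => [0, 1]
  | k + 1 => powMod p n rem (frobIter p n rem k) p

section
variable {R : Type*} [CommRing R] (θ : R)

@[simp] lemma eval_nil : eval θ [] = 0 := rfl
@[simp] lemma eval_cons (c : ℤ) (l : List ℤ) : eval θ (c :: l) = c + θ * eval θ l := rfl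

@[simp] lemma eval_add (a b : List ℤ) : eval θ (add a b) = eval θ a + eval θ b := by
  induction a generalizing b with
  | nil => simp [add]
  | cons x a ih =>
    cases b with
    | nil => simp [add]
    | cons y b => simp [add, ih]; ring

@[simp] lemma eval_scale (c : ℤ) (a : List ℤ) : eval θ (scale c a) = c * eval θ a := by
  induction a with
  | nil => simp [scale]
  | cons x a ih =>
    have : scale c (x :: a) = (c * x) :: scale c a := rfl
    rw [this, eval_cons, ih, eval_cons]; push_cast; ring

@[simp] lemma eval_mul (a b : List ℤ) : eval θ (mul a b) = eval θ a * eval θ b := by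
  induction a with
  | nil => simp [mul]
  | cons x a ih => simp [mul, ih]; ring

lemma cast_emod {m : ℤ} (hm : (m : R) = 0) (c : ℤ) : ((c % m : ℤ) : R) = c := by
  rw [Int.emod_def]; push_cast; simp [hm]

lemma eval_red {m : ℤ} (hm : (m : R) = 0) (a : List ℤ) : eval θ (red m a) = eval θ a := by
  induction a with
  | nil => rfl
  | cons x a ih =>
    have : red m (x :: a) = (x % m) :: red m a := rfl
    rw [this, eval_cons, ih, eval_cons, cast_emod hm]

lemma eval_take_drop (n : ℕ) (a : List ℤ) :
    eval θ a = eval θ (a.take n) + θ ^ n * eval θ (a.drop n) := by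
  induction n generalizing a with
  | zero => simp
  | succ n ih =>
    cases a with
    | nil => simp
    | cons x a => simp only [List.take_succ_cons, List.drop_succ_cons, eval_cons]; rw [ih a]; ring

lemma eval_eq_of_eqMod {m : ℤ} (hm : (m : R) = 0) {a b : List ℤ} (h : eqMod m a b = true) :
    eval θ a = eval θ b := by
  have key : ∀ l : List ℤ, (l.all fun c => c % m == 0) = true → eval θ l = 0 := by
    intro l hl
    induction l with
    | nil => rfl
    | cons x l ih =>
      simp only [List.all_cons, Bool.and_eq_true, beq_iff_eq] at hl
      rw [eval_cons, ih hl.2, ← cast_emod hm x, hl.1]; simp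
  have := key _ h
  simp only [eval_add, eval_scale] at this
  push_cast at this
  linear_combination this

variable {θ} {m : ℤ} {n : ℕ} {rem : List ℤ}

lemma eval_fold (hθ : θ ^ n = eval θ rem) (a : List ℤ) : eval θ (fold n rem a) = eval θ a := by
  rw [fold, eval_add, eval_mul, eval_take_drop θ n a, hθ]; ring

lemma eval_mulMod (hm : (m : R) = 0) (hθ : θ ^ n = eval θ rem) (a b : List ℤ) :
    eval θ (mulMod m n rem a b) = eval θ a * eval θ b := by
  induction a with
  | nil => simp [mulMod]
  | cons x a ih =>
    rw [mulMod, eval_red θ hm, eval_add, eval_scale, eval_fold hθ, eval_cons, ih, eval_cons]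
    push_cast; ring

lemma eval_powMod (hm : (m : R) = 0) (hθ : θ ^ n = eval θ rem) (a : List ℤ) (k : ℕ) :
    eval θ (powMod m n rem a k) = eval θ a ^ k := by
  induction k with
  | zero => simp [powMod]
  | succ k ih => rw [powMod, eval_mulMod hm hθ, ih, pow_succ']

lemma eval_frobIter {p : ℕ} (hp : (p : R) = 0) (hθ : θ ^ n = eval θ rem) (k : ℕ) :
    eval θ (frobIter p n rem k) = θ ^ p ^ k := by
  induction k with
  | zero => simp [frobIter]
  | succ k ih =>
    rw [frobIter, eval_powMod (by exact_mod_cast hp) hθ, ih, ← pow_mul, pow_succ]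

end

lemma eval_eq_aeval {R : Type*} [CommRing R] (θ : R) (a : List ℤ) :
    eval θ a = aeval θ (toPoly a) := by
  induction a with
  | nil => simp [toPoly]
  | cons x a ih => simp [toPoly, ih]

lemma map_toPoly {R : Type*} [CommRing R] (a : List ℤ) :
    (toPoly a).map (Int.castRingHom R) = eval (X : R[X]) a := by
  induction a with
  | nil => simp [toPoly]
  | cons x a ih => simp [toPoly, ih]

lemma toPoly_eq_eval (a : List ℤ) : toPoly a = eval (X : ℤ[X]) a := by
  induction a with
  | nil => simp [toPoly]
  | cons x a ih => simp [toPoly, ih]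

lemma derivative_toPoly (a : List ℤ) : derivative (toPoly a) = toPoly (deriv a) := by
  induction a with
  | nil => simp [toPoly, deriv]
  | cons x a ih =>
    rw [deriv, toPoly_eq_eval (add _ _), eval_add, eval_cons, ← toPoly_eq_eval, ← toPoly_eq_eval,
      ← ih, toPoly]
    simp

lemma map_eval {R S : Type*} [CommRing R] [CommRing S] (f : R →+* S) (θ : R) (a : List ℤ) :
    f (eval θ a) = eval (f θ) a := by
  induction a with
  | nil => simp
  | cons x a ih => simp [ih]

/-- A certificate that every root of `X ^ n - rem` in characteristic `p` has Frobenius period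
exactly `d`: for each listed `(e, u)` the list `u` inverts `X ^ (p ^ e) - X`. -/
def periodCert (p n : ℕ) (rem : List ℤ) (d : ℕ) (us : List (ℕ × List ℤ)) : Bool :=
  eqMod p (frobIter p n rem d) [0, 1] &&
    us.all fun eu => eqMod p (mulMod p n rem eu.2 (add (frobIter p n rem eu.1) [0, -1])) [1]

/-- If `θ` were fixed after `e` steps, evaluating the certified inverse relation at `θ` would give
`0 = 1`. No factorization is involved, and the same certificate serves every root in every ring of
characteristic `p`. -/
lemma periodCert_spec {R : Type*} [CommRing R] [Nontrivial R] {p n d : ℕ} {rem : List ℤ}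
    {us : List (ℕ × List ℤ)} (h : periodCert p n rem d us = true) (hp : (p : R) = 0) {θ : R}
    (hθ : θ ^ n = eval θ rem) :
    θ ^ p ^ d = θ ∧ ∀ eu ∈ us, θ ^ p ^ eu.1 ≠ θ := by
  have hp' : ((p : ℤ) : R) = 0 := by exact_mod_cast hp
  simp only [periodCert, Bool.and_eq_true, List.all_eq_true] at h
  refine ⟨?_, fun eu heu hc => ?_⟩
  · have := eval_eq_of_eqMod θ hp' h.1
    rw [eval_frobIter hp hθ] at this
    simpa using this
  · have := eval_eq_of_eqMod θ hp' (h.2 eu heu)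
    rw [eval_mulMod hp' hθ, eval_add, eval_frobIter hp hθ, hc] at this
    simp at this

end ListPoly

/-! ### Irreducibility from Frobenius periods -/

/-- The period of a point under an iterated map is `d` when the point returns after `d` steps but
not after `d / q` steps for the primes `q ∣ d`. -/
lemma dvd_of_pow_eq {R : Type*} [Monoid R] {p d : ℕ} {θ : R} (hd : θ ^ p ^ d = θ)
    (hq : ∀ q : ℕ, q.Prime → q ∣ d → θ ^ p ^ (d / q) ≠ θ) {m : ℕ} (hm : θ ^ p ^ m = θ) : d ∣ m := by
  have it : ∀ k, (fun x : R => x ^ p)^[k] θ = θ ^ p ^ k := by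
    intro k
    induction k with
    | zero => simp
    | succ k ih => rw [Function.iterate_succ_apply', ih, ← pow_mul, pow_succ]
  have h1 : Function.minimalPeriod (fun x : R => x ^ p) θ ∣ d :=
    Function.IsPeriodicPt.minimalPeriod_dvd
      (by rw [Function.IsPeriodicPt, Function.IsFixedPt, it, hd])
  have h2 : Function.minimalPeriod (fun x : R => x ^ p) θ ∣ m :=
    Function.IsPeriodicPt.minimalPeriod_dvd
      (by rw [Function.IsPeriodicPt, Function.IsFixedPt, it, hm])
  obtain ⟨e, he⟩ := h1
  by_cases h1 : e = 1
  · rw [h1, mul_one] at he; rwa [he]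
  exfalso
  -- A minimal period properly dividing `d` already divides `d / q` for a prime `q` of the cofactor.
  obtain ⟨q, hqp, hqe⟩ := Nat.exists_prime_and_dvd h1
  obtain ⟨f, rfl⟩ := hqe
  have hdq : d / q = Function.minimalPeriod (fun x : R => x ^ p) θ * f := by
    rw [he, show Function.minimalPeriod (fun x : R => x ^ p) θ * (q * f) =
      q * (Function.minimalPeriod (fun x : R => x ^ p) θ * f) by ring]
    exact Nat.mul_div_cancel_left _ hqp.pos
  apply hq q hqp (he ▸ ⟨Function.minimalPeriod (fun x : R => x ^ p) θ * f, by ring⟩)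
  rw [← it, hdq]
  exact (Function.isPeriodicPt_minimalPeriod _ θ).mul_const f

/-- The coefficients of `g₀`, lowest degree first. -/
def g0Coeffs : List ℤ :=
  [217152, -994304, 455488, 1664960, 352880, -382272, -133760, 18480, 9768, -88, -220, -4, 1]

/-- The polynomial `X ^ 12 - g₀`. -/
def g0Rem : List ℤ :=
  [-217152, 994304, -455488, -1664960, -352880, 382272, 133760, -18480, -9768, 88, 220, 4]

noncomputable def g0Int : ℤ[X] := ListPoly.toPoly g0Coeffs

lemma g0Int_map : g0Int.map (Int.castRingHom ℚ) = g₀ := by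
  rw [g0Int, ListPoly.map_toPoly, g₀]
  simp only [g0Coeffs, ListPoly.eval]
  push_cast
  ring

lemma toPoly_append_one (l : List ℤ) (h : l ≠ []) :
    (ListPoly.toPoly (l ++ [1])).Monic ∧ (ListPoly.toPoly (l ++ [1])).natDegree = l.length := by
  induction l with
  | nil => exact absurd rfl h
  | cons x l ih =>
    rw [List.cons_append, ListPoly.toPoly]
    have key : (ListPoly.toPoly (l ++ [1])).Monic ∧
        (ListPoly.toPoly (l ++ [1])).natDegree = l.length := by
      rcases l with _ | ⟨y, l⟩
      · simp [ListPoly.toPoly]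
      · exact ih (by simp)
    have hne : ListPoly.toPoly (l ++ [1]) ≠ 0 := key.1.ne_zero
    have hm : (X * ListPoly.toPoly (l ++ [1])).Monic := monic_X.mul key.1
    have hd : (X * ListPoly.toPoly (l ++ [1])).natDegree = l.length + 1 := by
      rw [natDegree_X_mul hne, key.2]
    have hlt : (C x : ℤ[X]).degree < (X * ListPoly.toPoly (l ++ [1])).degree := by
      rw [degree_eq_natDegree hm.ne_zero, hd]
      exact lt_of_le_of_lt degree_C_le (by exact_mod_cast Nat.succ_pos _)
    refine ⟨hm.add_of_right hlt, ?_⟩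
    rw [natDegree_add_eq_right_of_degree_lt hlt, hd, List.length_cons]

lemma g0Int_monic : g0Int.Monic :=
  (toPoly_append_one (g0Coeffs.dropLast) (by simp [g0Coeffs])).1

lemma g0Int_natDegree : g0Int.natDegree = 12 :=
  (toPoly_append_one (g0Coeffs.dropLast) (by simp [g0Coeffs])).2

section
variable {R : Type*} [CommRing R] (θ : R)

lemma pow_eq_of_eval_g0 (h : ListPoly.eval θ g0Coeffs = 0) : θ ^ 12 = ListPoly.eval θ g0Rem := by
  simp only [g0Coeffs, g0Rem, ListPoly.eval] at *
  push_cast at *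
  linear_combination h

end

/-- A monic polynomial all of whose roots in extensions of `ZMod p` have Frobenius period equal to
its degree is irreducible. -/
lemma irreducible_of_period {p : ℕ} [Fact p.Prime] {f : (ZMod p)[X]} (hf : f.Monic)
    (hdeg : f.natDegree ≠ 0)
    (h : ∀ (k : Type) [Field k] [Algebra (ZMod p) k] (θ : k), aeval θ f = 0 →
      ∀ m : ℕ, θ ^ p ^ m = θ → f.natDegree ∣ m) : Irreducible f := by
  have hu : ¬ IsUnit f := fun hu => hdeg (natDegree_eq_zero_of_isUnit hu)
  -- Adjoining a root of an irreducible factor `q` gives a field with `p ^ deg q` elements, in which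
  -- the root returns after `deg q` steps. Hence `deg f` divides `deg q`, and the cofactor is
  -- constant.
  obtain ⟨q, hq, hqf⟩ := WfDvdMonoid.exists_irreducible_factor hu hf.ne_zero
  have := Fact.mk hq
  have h0 : aeval (AdjoinRoot.root q) f = 0 := by
    obtain ⟨c, rfl⟩ := hqf
    rw [map_mul, AdjoinRoot.aeval_eq, AdjoinRoot.mk_self, zero_mul]
  have : FiniteDimensional (ZMod p) (AdjoinRoot q) :=
    (AdjoinRoot.powerBasis hq.ne_zero).finite
  have : Finite (AdjoinRoot q) := Module.finite_of_finite (ZMod p)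
  have hcard : Nat.card (AdjoinRoot q) = p ^ q.natDegree := by
    rw [Module.natCard_eq_pow_finrank (K := ZMod p), Nat.card_zmod,
      (AdjoinRoot.powerBasis hq.ne_zero).finrank, AdjoinRoot.powerBasis_dim]
  have := Fintype.ofFinite (AdjoinRoot q)
  have hroot : (AdjoinRoot.root q) ^ p ^ q.natDegree = AdjoinRoot.root q := by
    rw [← hcard, Nat.card_eq_fintype_card, FiniteField.pow_card]
  have hdvd := h (AdjoinRoot q) (AdjoinRoot.root q) h0 _ hroot
  have hle : f.natDegree ≤ q.natDegree := Nat.le_of_dvd hq.natDegree_pos hdvd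
  obtain ⟨c, rfl⟩ := hqf
  have hc : c ≠ 0 := right_ne_zero_of_mul hf.ne_zero
  rw [natDegree_mul hq.ne_zero hc] at hle
  have hcu : IsUnit c := isUnit_iff_degree_eq_zero.mpr (by
    rw [degree_eq_natDegree hc]; exact_mod_cast (by omega : c.natDegree = 0))
  exact (irreducible_mul_isUnit hcu).mpr hq

/-- Irreducibility over the rationals of an integer polynomial from a period certificate. -/
lemma irreducible_of_periodCert {p n : ℕ} [Fact p.Prime] {l rem : List ℤ} {us : List (ℕ × List ℤ)}
    (hn : n ≠ 0) (hl : (ListPoly.toPoly l).Monic) (hdeg : (ListPoly.toPoly l).natDegree = n)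
    (hrem : ∀ (k : Type) [Field k] (θ : k), ListPoly.eval θ l = 0 → θ ^ n = ListPoly.eval θ rem)
    (hcert : ListPoly.periodCert p n rem n us = true)
    (hus : ∀ q : ℕ, q.Prime → q ∣ n → n / q ∈ us.map Prod.fst) :
    Irreducible ((ListPoly.toPoly l).map (Int.castRingHom ℚ)) := by
  rw [← algebraMap_int_eq, ← hl.irreducible_iff_irreducible_map_fraction_map]
  have hd : ((ListPoly.toPoly l).map (Int.castRingHom (ZMod p))).natDegree = n := by
    rw [hl.natDegree_map, hdeg]
  refine hl.irreducible_of_irreducible_map (Int.castRingHom (ZMod p)) _ ?_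
  refine irreducible_of_period (hl.map _) (by rw [hd]; exact hn) ?_
  intro k _ _ θ hθ m hm
  rw [hd]
  have hp : (p : k) = 0 := by
    have := map_natCast (algebraMap (ZMod p) k) p
    rw [ZMod.natCast_self, map_zero] at this
    exact this.symm
  have h0 : ListPoly.eval θ l = 0 := by
    rw [ListPoly.eval_eq_aeval, ← hθ, ← algebraMap_int_eq, aeval_map_algebraMap]
  obtain ⟨h1, h2⟩ := ListPoly.periodCert_spec hcert hp (hrem k θ h0)
  refine dvd_of_pow_eq h1 (fun q hq hqn => ?_) hm
  obtain ⟨eu, heu, he⟩ := List.mem_map.mp (hus q hq hqn)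
  rw [← he]; exact h2 eu heu

lemma prime_dvd_twelve {q : ℕ} (hq : q.Prime) (h : q ∣ 12) : q = 2 ∨ q = 3 := by
  have : q ≤ 12 := Nat.le_of_dvd (by norm_num) h
  interval_cases q <;> revert hq h <;> decide

lemma g0_irreducible : Irreducible g₀ := by
  have : Fact (Nat.Prime 5) := ⟨by norm_num⟩
  rw [← g0Int_map]
  -- The two lists invert `X ^ 5 ^ 6 - X` and `X ^ 5 ^ 4 - X` modulo 5 and `g₀`; 6 and 4 are the
  -- maximal proper divisors of 12.
  refine irreducible_of_periodCert (p := 5) (n := 12) (rem := g0Rem)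
    (us := [(6, [1, 2, 4, 2, 1, 3, 2, 1, 0, 4, 1, 1]), (4, [3, 0, 1, 2, 2, 3, 2, 1, 2, 4, 2, 4])])
    (by norm_num) g0Int_monic g0Int_natDegree (fun k _ θ h => pow_eq_of_eval_g0 θ h)
    (by decide +kernel) ?_
  intro q hq h
  rcases prime_dvd_twelve hq h with rfl | rfl <;> simp

-- A lower bound for the Galois group from Frobenius elements

universe u

section
variable {L : Type u} [Field L] [NumberField L]

/-- A Frobenius element: for every prime `p` there are an automorphism and a ring homomorphism from
the integers of `L` to a field of characteristic `p` that turns it into `x ↦ x ^ p`. -/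
lemma exists_frobenius [IsGalois ℚ L] (p : ℕ) (hp : p.Prime) :
    ∃ (σ : L ≃ₐ[ℚ] L) (k : Type u) (_ : Field k) (f : 𝓞 L →+* k),
      (p : k) = 0 ∧ ∀ x, f (σ • x) = f x ^ p := by
  have hpr : (Ideal.span {(p : ℤ)}).IsPrime :=
    (Ideal.span_singleton_prime (by exact_mod_cast hp.ne_zero)).mpr (Nat.prime_iff_prime_int.mp hp)
  obtain ⟨P, hP, hPo⟩ := Ideal.exists_ideal_over_prime_of_isIntegral (S := 𝓞 L)
    (Ideal.span {(p : ℤ)}) ⊥ (by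
      rw [← RingHom.ker_eq_comap_bot, (RingHom.injective_iff_ker_eq_bot _).mp
        (FaithfulSMul.algebraMap_injective ℤ (𝓞 L))]
      exact bot_le)
  obtain ⟨hPp, hPc⟩ := hPo
  have hpP : (p : 𝓞 L) ∈ P := by
    have : (p : ℤ) ∈ Ideal.comap (algebraMap ℤ (𝓞 L)) P := by
      rw [hPc]; exact Ideal.mem_span_singleton_self _
    simpa using this
  have hPne : P ≠ ⊥ := by
    rintro rfl
    have : (p : 𝓞 L) = 0 := by simpa using hpP
    exact hp.ne_zero (by exact_mod_cast this)
  have hmax : P.IsMaximal := hPp.isMaximal hPne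
  have hfin : Finite (𝓞 L ⧸ P) := Ideal.finiteQuotientOfFreeOfNeBot P hPne
  have hunder : Nat.card (ℤ ⧸ P.under ℤ) = p := by
    have : P.under ℤ = Ideal.span {(p : ℤ)} := hPc
    rw [this, Nat.card_congr (Int.quotientSpanNatEquivZMod p).toEquiv, Nat.card_zmod]
  refine ⟨arithFrobAt ℤ (L ≃ₐ[ℚ] L) P, 𝓞 L ⧸ P, Ideal.Quotient.field P, Ideal.Quotient.mk P, ?_, ?_⟩
  · rw [← map_natCast (Ideal.Quotient.mk P)]
    exact Ideal.Quotient.eq_zero_iff_mem.mpr hpP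
  · intro x
    have := IsArithFrobAt.arithFrobAt (R := ℤ) (G := L ≃ₐ[ℚ] L) (Q := P) x
    rw [hunder] at this
    rw [← map_pow]
    exact Ideal.Quotient.eq.mpr this

/-- An integer polynomial with a full set of roots is the product of its linear factors. -/
lemma g0_eq_prod {A : Type*} [CommRing A] [IsDomain A] {r : Fin 12 → A}
    (hinj : Function.Injective r) (hr : ∀ i, ListPoly.eval (r i) g0Coeffs = 0) :
    g0Int.map (Int.castRingHom A) = ∏ i, (X - C (r i)) := by
  have hm : (g0Int.map (Int.castRingHom A)).Monic := g0Int_monic.map _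
  have hroots : (g0Int.map (Int.castRingHom A)).roots = Finset.univ.val.map r := by
    symm
    apply Multiset.eq_of_le_of_card_le
    · rw [Multiset.le_iff_subset (Multiset.Nodup.map hinj Finset.univ.nodup)]
      intro x hx
      obtain ⟨i, -, rfl⟩ := Multiset.mem_map.mp hx
      rw [mem_roots hm.ne_zero, IsRoot, eval_map, ← hr i, ListPoly.eval_eq_aeval]
      rfl
    · refine (card_roots' _).trans ?_
      rw [g0Int_monic.natDegree_map, g0Int_natDegree]; simp
  have hcard : (g0Int.map (Int.castRingHom A)).roots.card =
      (g0Int.map (Int.castRingHom A)).natDegree := by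
    rw [hroots, g0Int_monic.natDegree_map, g0Int_natDegree]; simp
  have := prod_multiset_X_sub_C_of_monic_of_roots_card_eq hm hcard
  rw [← this, hroots, Multiset.map_map]
  rfl

/-- Transporting the factorization along `f` shows that a root of `g₀` in a domain `B` is the image
of some `r i`. This is how roots in residue fields, in the reals and in the complex numbers are
identified. -/
lemma eval_g0_eq_prod {A B : Type*} [CommRing A] [IsDomain A] [CommRing B] {r : Fin 12 → A}
    (hinj : Function.Injective r) (hr : ∀ i, ListPoly.eval (r i) g0Coeffs = 0) (f : A →+* B)
    (x : B) : ListPoly.eval x g0Coeffs = ∏ i, (x - f (r i)) := by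
  have := congrArg (eval₂ f x) (g0_eq_prod hinj hr)
  rw [eval₂_map, eval₂_finsetProd] at this
  simp only [eval₂_sub, eval₂_X, eval₂_C] at this
  rw [← this, ListPoly.eval_eq_aeval]
  have hf : f.comp (Int.castRingHom A) = Int.castRingHom B := RingHom.ext_int _ _
  rw [hf]; rfl

/-- Distinct roots stay distinct modulo a prime where the derivative is invertible. -/
lemma map_root_injective {A B : Type*} [CommRing A] [IsDomain A] [Field B] {r : Fin 12 → A}
    (hinj : Function.Injective r) (hr : ∀ i, ListPoly.eval (r i) g0Coeffs = 0) (f : A →+* B)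
    (hder : ∀ x : B, ListPoly.eval x g0Coeffs = 0 →
      ListPoly.eval x (ListPoly.deriv g0Coeffs) ≠ 0) :
    Function.Injective (fun i => f (r i)) := by
  intro i j hij
  by_contra hne
  have hp : g0Int.map (Int.castRingHom B) = ∏ i, (X - C (f (r i))) := by
    have := congrArg (Polynomial.map f) (g0_eq_prod hinj hr)
    rw [Polynomial.map_map, Polynomial.map_prod] at this
    simpa [RingHom.ext_int (f.comp (Int.castRingHom A)) (Int.castRingHom B)] using this
  have hsq : (X - C (f (r i))) * (X - C (f (r i))) ∣ g0Int.map (Int.castRingHom B) := by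
    rw [hp, ← Finset.mul_prod_erase _ _ (Finset.mem_univ i),
      ← Finset.mul_prod_erase _ _ (Finset.mem_erase.mpr ⟨Ne.symm hne, Finset.mem_univ j⟩)]
    simp only at hij
    rw [← hij, ← mul_assoc]
    exact dvd_mul_right _ _
  apply hder (f (r i)) (by rw [← ListPoly.map_eval, hr, map_zero])
  obtain ⟨q, hq⟩ := hsq
  rw [ListPoly.eval_eq_aeval, ← ListPoly.derivative_toPoly]
  have h1 : aeval (f (r i)) (derivative g0Int) =
      eval (f (r i)) (derivative (g0Int.map (Int.castRingHom B))) := by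
    rw [derivative_map, eval_map]; rfl
  change aeval (f (r i)) (derivative g0Int) = 0
  rw [h1, hq]
  simp [derivative_mul]

variable {r : Fin 12 → 𝓞 L}

lemma listEval_smul (σ : L ≃ₐ[ℚ] L) (x : 𝓞 L) (l : List ℤ) :
    ListPoly.eval (σ • x) l = σ • ListPoly.eval x l :=
  (ListPoly.map_eval (MulSemiringAction.toRingHom (L ≃ₐ[ℚ] L) (𝓞 L) σ) x l).symm

omit [NumberField L] in
lemma exists_eq_of_eval_g0 (hinj : Function.Injective r)
    (hr : ∀ i, ListPoly.eval (r i) g0Coeffs = 0) {x : 𝓞 L} (hx : ListPoly.eval x g0Coeffs = 0) :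
    ∃ i, x = r i := by
  rw [eval_g0_eq_prod hinj hr (RingHom.id _), Finset.prod_eq_zero_iff] at hx
  obtain ⟨i, -, hi⟩ := hx
  exact ⟨i, sub_eq_zero.mp hi⟩

/-- If modulo `p` the polynomial `g₀` is separable with a root `a`, and away from the listed
residues its roots have Frobenius period `d`, then `d` divides the order of the stabiliser of
some root. -/
lemma exists_dvd_card_stabilizer [IsGalois ℚ L] {p n d : ℕ} (hp : p.Prime)
    (hinj : Function.Injective r) (hr : ∀ i, ListPoly.eval (r i) g0Coeffs = 0)
    {a : ℤ} {as w h rem : List ℤ} {us : List (ℕ × List ℤ)}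
    (hw : ListPoly.eqMod p
      (ListPoly.mulMod p 12 g0Rem w (ListPoly.deriv g0Coeffs)) [1] = true)
    (ha : (p : ℤ) ∣ ListPoly.eval a g0Coeffs) (has : as.length < 12)
    (hfac : ∀ (k : Type u) [Field k], (p : k) = 0 → ∀ θ : k, ListPoly.eval θ g0Coeffs = 0 →
      (∃ b ∈ as, θ = (b : k)) ∨ ListPoly.eval θ h = 0)
    (hrem : ∀ (k : Type u) [Field k] (θ : k), (p : k) = 0 → ListPoly.eval θ h = 0 →
      θ ^ n = ListPoly.eval θ rem)
    (hcert : ListPoly.periodCert p n rem d us = true)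
    (hus : ∀ q : ℕ, q.Prime → q ∣ d → d / q ∈ us.map Prod.fst) :
    ∃ i, d ∣ Nat.card (MulAction.stabilizer (L ≃ₐ[ℚ] L) (r i)) := by
  obtain ⟨σ, k, _, f, hpk, hf⟩ := exists_frobenius (L := L) p hp
  have hpk' : ((p : ℤ) : k) = 0 := by exact_mod_cast hpk
  have hθ0 : ∀ i, ListPoly.eval (f (r i)) g0Coeffs = 0 := fun i => by
    rw [← ListPoly.map_eval, hr, map_zero]
  -- `w` inverts the derivative modulo `p` and `g₀`, so no root in characteristic `p` is multiple.
  have hθ : Function.Injective (fun i => f (r i)) := by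
    refine map_root_injective hinj hr f fun x hx h0 => ?_
    have := ListPoly.eval_eq_of_eqMod x hpk' hw
    rw [ListPoly.eval_mulMod hpk' (pow_eq_of_eval_g0 x hx), h0] at this
    simp at this
  obtain ⟨i, hi⟩ : ∃ i, f (r i) = (a : k) := by
    have h0 : ListPoly.eval (a : k) g0Coeffs = 0 := by
      have h1 := ListPoly.map_eval (Int.castRingHom k) a g0Coeffs
      obtain ⟨c, hc⟩ := ha
      rw [hc] at h1
      simp only [eq_intCast] at h1
      rw [← h1]; push_cast; rw [hpk]; ring
    rw [eval_g0_eq_prod hinj hr f, Finset.prod_eq_zero_iff] at h0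
    obtain ⟨i, -, hi⟩ := h0
    exact ⟨i, (sub_eq_zero.mp hi).symm⟩
  -- The image of `r i` lies in the prime field, so Frobenius fixes it, and reduction separates the
  -- roots.
  have hfix : σ • r i = r i := by
    obtain ⟨j, hj⟩ := exists_eq_of_eval_g0 hinj hr (x := σ • r i) (by
      rw [listEval_smul, hr, smul_zero])
    have : f (r j) = f (r i) := by
      rw [← hj, hf, hi]
      have : Fact p.Prime := ⟨hp⟩
      have : CharP k p := (CharP.charP_iff_prime_eq_zero hp).mpr hpk
      exact map_intCast (frobenius k p) a
    rw [hj, hθ this]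
  -- Twelve distinct reductions cannot all lie among fewer than twelve listed residues, so some root
  -- reduces to a root of `h`.
  obtain ⟨j, hj⟩ : ∃ j, ¬ ∃ b ∈ as, f (r j) = (b : k) := by
    by_contra! hall
    classical
    have h1 : (Finset.univ.image fun i => f (r i)) ⊆ (as.map (fun b : ℤ => (b : k))).toFinset := by
      intro x hx
      obtain ⟨j, -, rfl⟩ := Finset.mem_image.mp hx
      obtain ⟨b, hb, hbj⟩ := hall j
      rw [List.mem_toFinset]
      exact List.mem_map.mpr ⟨b, hb, hbj.symm⟩
    have h2 := (Finset.card_le_card h1).trans (List.toFinset_card_le _)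
    rw [Finset.card_image_of_injective _ hθ, List.length_map] at h2
    simp at h2; omega
  have hh : ListPoly.eval (f (r j)) h = 0 := (hfac k hpk _ (hθ0 j)).resolve_left hj
  obtain ⟨h1, h2⟩ := ListPoly.periodCert_spec hcert hpk (hrem k _ hpk hh)
  have hd : ∀ m : ℕ, f (r j) ^ p ^ m = f (r j) → d ∣ m := fun m hm =>
    dvd_of_pow_eq h1 (fun q hq hqd => by
      obtain ⟨eu, heu, he⟩ := List.mem_map.mp (hus q hq hqd)
      rw [← he]; exact h2 eu heu) hm
  have hpow : ∀ m : ℕ, f (σ ^ m • r j) = f (r j) ^ p ^ m := by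
    intro m
    induction m with
    | zero => simp
    | succ m ih => rw [pow_succ', mul_smul, hf, ih, ← pow_mul, pow_succ]
  -- The reduction of `r j` returns after `orderOf σ` Frobenius steps, so its period `d` divides
  -- that order; and `σ` stabilises `r i`.
  refine ⟨i, (hd (orderOf σ) ?_).trans ?_⟩
  · rw [← hpow, pow_orderOf_eq_one, one_smul]
  · have := orderOf_dvd_natCard (⟨σ, hfix⟩ : MulAction.stabilizer (L ≃ₐ[ℚ] L) (r i))
    have h3 := Subgroup.orderOf_coe (⟨σ, hfix⟩ : MulAction.stabilizer (L ≃ₐ[ℚ] L) (r i))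
    rw [← h3] at this; exact this

/-- The Galois group is transitive on the roots. -/
lemma exists_smul_root [IsGalois ℚ L] (hr : ∀ i, ListPoly.eval (r i) g0Coeffs = 0) (i j : Fin 12) :
    ∃ σ : L ≃ₐ[ℚ] L, σ • r i = r j := by
  have hmin : ∀ i, minpoly ℚ (r i : L) = g₀ := by
    intro i
    refine (minpoly.eq_of_irreducible_of_monic g0_irreducible ?_ ?_).symm
    · have := ListPoly.map_eval (algebraMap (𝓞 L) L) (r i) g0Coeffs
      rw [hr, map_zero] at this
      rw [← g0Int_map, ← algebraMap_int_eq, aeval_map_algebraMap, g0Int, ← ListPoly.eval_eq_aeval]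
      exact this.symm
    · rw [← g0Int_map]; exact g0Int_monic.map _
  obtain ⟨σ, hσ⟩ := (Normal.minpoly_eq_iff_mem_orbit (F := ℚ) L).mp ((hmin j).trans (hmin i).symm)
  exact ⟨σ, RingOfIntegers.ext hσ⟩

lemma card_eq_twelve_mul_card_stabilizer [IsGalois ℚ L] (hinj : Function.Injective r)
    (hr : ∀ i, ListPoly.eval (r i) g0Coeffs = 0) (i : Fin 12) :
    Nat.card (L ≃ₐ[ℚ] L) = 12 * Nat.card (MulAction.stabilizer (L ≃ₐ[ℚ] L) (r i)) := by
  have horb : MulAction.orbit (L ≃ₐ[ℚ] L) (r i) = Set.range r := by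
    ext x
    constructor
    · rintro ⟨σ, rfl⟩
      obtain ⟨j, hj⟩ := exists_eq_of_eval_g0 hinj hr (x := σ • r i) (by
        rw [listEval_smul, hr, smul_zero])
      exact ⟨j, hj.symm⟩
    · rintro ⟨j, rfl⟩
      exact exists_smul_root hr i j
  rw [Subgroup.card_eq_card_quotient_mul_card_subgroup
    (MulAction.stabilizer (L ≃ₐ[ℚ] L) (r i)),
    Nat.card_congr (MulAction.orbitEquivQuotientStabilizer (L ≃ₐ[ℚ] L) (r i)).symm, horb,
    Nat.card_congr (Equiv.ofInjective r hinj).symm]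
  simp

/-- Modulo 7 there are the roots 1 and 4 and a factor of degree 10 whose roots have period 10;
modulo 29 there is the root 0 and a factor of degree 11 whose roots have period 11. Orbit and
stabiliser give the divisors 12 · 10 and 12 · 11, with least common multiple 1320. -/
theorem dvd_card_galois [IsGalois ℚ L] (hinj : Function.Injective r)
    (hr : ∀ i, ListPoly.eval (r i) g0Coeffs = 0) : 1320 ∣ Nat.card (L ≃ₐ[ℚ] L) := by
  have h10 : 120 ∣ Nat.card (L ≃ₐ[ℚ] L) := by
    obtain ⟨i, hi⟩ := exists_dvd_card_stabilizer (p := 7) (n := 10) (d := 10) (by norm_num) hinj hr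
      (a := 1) (as := [1, 4]) (w := [4, 1, 0, 6, 5, 3, 3, 6, 2, 3, 0, 4])
      (h := [3, 3, 6, 4, 6, 6, 5, 3, 5, 1, 1]) (rem := [4, 4, 1, 3, 1, 1, 2, 4, 2, 6])
      (us := [(5, [4, 3, 3, 0, 6, 5, 0, 1, 1]), (2, [4, 5, 2, 0, 4, 5, 5, 6, 6, 2])])
      (by decide +kernel) (by decide +kernel) (by simp)
      (by
        intro k _ hk θ hθ
        have hk' : ((7 : ℤ) : k) = 0 := by exact_mod_cast hk
        have := ListPoly.eval_eq_of_eqMod θ hk' (a := g0Coeffs)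
          (b := ListPoly.mul (ListPoly.mul [-1, 1] [-4, 1]) [3, 3, 6, 4, 6, 6, 5, 3, 5, 1, 1])
          (by decide +kernel)
        rw [hθ, ListPoly.eval_mul, ListPoly.eval_mul] at this
        rcases mul_eq_zero.mp this.symm with h | h
        · rcases mul_eq_zero.mp h with h | h
          · refine Or.inl ⟨1, by simp, ?_⟩
            simp [ListPoly.eval] at h
            push_cast; linear_combination h
          · refine Or.inl ⟨4, by simp, ?_⟩
            simp [ListPoly.eval] at h
            push_cast; linear_combination h
        · exact Or.inr h)
      (by
        intro k _ θ hk h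
        have hk : (7 : k) = 0 := by exact_mod_cast hk
        simp only [ListPoly.eval] at h ⊢
        push_cast at h ⊢
        -- Each entry of `rem` is 7 minus the corresponding entry of the list `h`, which accounts
        -- for 7 times the sum of the powers.
        linear_combination h - (1 + θ + θ ^ 2 + θ ^ 3 + θ ^ 4 + θ ^ 5 + θ ^ 6 + θ ^ 7 + θ ^ 8
          + θ ^ 9) * hk)
      (by decide +kernel)
      (by
        intro q hq hd
        have : q ≤ 10 := Nat.le_of_dvd (by norm_num) hd
        have : q = 2 ∨ q = 5 := by interval_cases q <;> revert hq hd <;> decide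
        rcases this with rfl | rfl <;> simp)
    rw [card_eq_twelve_mul_card_stabilizer hinj hr i]
    exact Nat.mul_dvd_mul_left 12 hi
  have h11 : 132 ∣ Nat.card (L ≃ₐ[ℚ] L) := by
    obtain ⟨i, hi⟩ := exists_dvd_card_stabilizer (p := 29) (n := 11) (d := 11) (by norm_num) hinj hr
      (a := 0) (as := [0]) (w := [26, 19, 9, 26, 27, 3, 2, 24, 7, 16, 9, 13])
      (h := [19, 14, 12, 8, 6, 17, 7, 24, 28, 12, 25, 1])
      (rem := [10, 15, 17, 21, 23, 12, 22, 5, 1, 17, 4])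
      (us := [(1, [11, 28, 0, 14, 18, 13, 26, 1, 14, 12, 5])])
      (by decide +kernel) (by decide +kernel) (by simp)
      (by
        intro k _ hk θ hθ
        have hk' : ((29 : ℤ) : k) = 0 := by exact_mod_cast hk
        have := ListPoly.eval_eq_of_eqMod θ hk' (a := g0Coeffs)
          (b := ListPoly.mul [0, 1] [19, 14, 12, 8, 6, 17, 7, 24, 28, 12, 25, 1])
          (by decide +kernel)
        rw [hθ, ListPoly.eval_mul] at this
        rcases mul_eq_zero.mp this.symm with h | h
        · refine Or.inl ⟨0, by simp, ?_⟩
          simp [ListPoly.eval] at h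
          simpa using h
        · exact Or.inr h)
      (by
        intro k _ θ hk h
        have hk : (29 : k) = 0 := by exact_mod_cast hk
        simp only [ListPoly.eval] at h ⊢
        push_cast at h ⊢
        linear_combination h - (1 + θ + θ ^ 2 + θ ^ 3 + θ ^ 4 + θ ^ 5 + θ ^ 6 + θ ^ 7 + θ ^ 8
          + θ ^ 9 + θ ^ 10) * hk)
      (by decide +kernel)
      (by
        intro q hq hd
        rcases (Nat.dvd_prime (by norm_num : Nat.Prime 11)).mp hd with rfl | rfl
        · exact absurd hq Nat.not_prime_one
        · simp)
    rw [card_eq_twelve_mul_card_stabilizer hinj hr i]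
    exact Nat.mul_dvd_mul_left 12 hi
  exact (by norm_num : Nat.lcm 120 132 = 1320) ▸ Nat.lcm_dvd h10 h11

end

/-! ### Hexads and their resolvent -/

/-- A polynomial in `(s - 2) ^ 2 - 374`, where `s` runs over the sums of the roots of `g₀` over the
hexads. -/
def hexadResolvent : List ℤ :=
  [1757561536420940708931487290093934621211603561400653837111624784243810903056293520009839178426098307409962347396170861082836992,
   -6704629533300662300214196861321977683936530792562996354553795374661657646618353793421723690887076270342120598804196083980304384,
   -295973583992225146724183841612545068884688746834795686771803365813996984756197623341205395052405277990948494185782193455890432,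
   25347684355916540562090683536725539083290862762664734887593260640686440374386849662788464858116518973663168622336308265615360,
   2515491792670201976264327379548482794832905703518499033786737872088297885075286527916206391215229482872261357413922427109376,
   76563295776899075895401818731480506301533289728741004206898068142160965121018038645146626906460580638449021223711669223424,
   -177258474953459852014685204628952318501166313929780601848335957741882869259069269917058907779859915880966716461384990720,
   -91354362920508252899172401766819241392234385994454552586893509550867834289878999817022417828136230109986092062257184768,
   -3379649791347557128635819322893025525711716685560591818121793427054526814569778604025405915648984375046976376959664128,
   -60017976820342005620776386171150014539587131511457914008136754677649881228038898836804748255853996513437397372895232,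
   -193854212178504580847740039571391398935484858932092255147992062173669786093727860497560619327741642051152395632640,
   19547834263384943385413372744651686292731204250286737823423036478983387701657112106396206450969433311816496185344,
   610164216889264926569253528831690422808919090541970662050026341478114281917865859090862544017534722656874528768,
   10015018602376712015019396061306342124085057654203818758513807473353447877233046941569027132389671259145764864,
   88991338043458081857949610748504090171994871646047299794726996084847924190116432313034874431958796422086656,
   -154048599680629296019024987474540137375949329320987009442660918561797083674621199743486299423291356479488,
   -20461856157078934659016007774232330622018952668275836158460652697454427566955422341197402554065934614528,
   -399808675826811373378607568499917315261295595963850403531015727836235261624551286565156969873032609792,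
   -4889168911080333768433317616417744422901277348845712192993883901228760271585413168778839050751574016,
   -39920530911107384535680110663064499734169093731726553559424632293831424192044218308263686069813248,
   -148384812101872499301912556280590072247362558576359271668605410304577960031039165199048891170816,
   1658118323183233880435456484443035774986545681209916448997845983766448770814046240530367512576,
   42596719147991676695306573823547707167951593365362446327622995412545048944090251698815107072,
   557433616174152291343482820191684101267129067345171915406518524279759663113075543592927232,
   5531269243848470683346240295473868306658323728401239341986088336840496944301672149024768,
   45636801963855193187983751484474056011439320161814741599201875430754966881051651080192,
   325233662878316579403248770183940438657300940969515220910544575278922365878820405248,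
   2042498530595387813614644067754275271054776531765067980932173445570525103759818752,
   11440526316680272831858889172711109187818144975155468008527065359109976829722624,
   57604873839702827765394141638018088338936927568737023673759292473315906551808,
   262138764735576445257893619379044407356345532528402553365174539234249277440,
   1082148883405949586119693547004337904042093526666971334065676002757967872,
   4063077691002845245524236399442999450522381492151656056158931069698048,
   13899219209682341733725474994816782971204607528005821232104603648000,
   43365922277969928634685178619038869587461380160555223733237710848,
   123461688477110282467130217540975392545056925453164474252918784,
   320713936545708995791752372466367726597778666573368572510208,
   759748949142787927005339681811760728046371875901625073664,
   1639629621815502162363483856178663392323355687506018304,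
   3218761330106146656017507799685506003379016142749696,
   5736107255248898706755214701045197280115501563904, 9255528135199899451517767188321075488668778496,
   13478130657220245870858302405694184897249280, 17642680983739133779259020505607387037696,
   20657452610410022234061484605720168448, 21505865649933324001565068284009472,
   19760162892823449493665840670208, 15877336256889144673582788864, 11027219075901271736732800,
   6521370857588737089984, 3219185868743173472, 1290449578972048, 403522738872, 92333076, 13750, 1]

/-- Bit masks of the hexads that contain the last point. -/
def hexadMasks : List ℕ :=
  [2141, 2155, 2191, 2234, 2262, 2289, 2334, 2343, 2361, 2387, 2420, 2453, 2476, 2505, 2530, 2583,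
   2620, 2638, 2661, 2674, 2713, 2726, 2755, 2792, 2829, 2858, 2904, 2962, 2977, 3012, 3118, 3125,
   3143, 3192, 3219, 3228, 3241, 3274, 3300, 3339, 3378, 3404, 3425, 3462, 3536, 3610, 3619, 3657,
   3668, 3717, 3760, 3857, 3876, 3906, 3976]

/-- The roots of `g₀` modulo `2293 ^ 2`. -/
def splitRoots : List ℤ :=
  [3864804, 3360494, 38155, 5085810, 3333115, 1609279, 3411387, 1875424, 269864, 4851654, 494458,
   3352654]

/-- The set of points with a given bit mask. -/
def maskSet (m : ℕ) : Finset (Fin 12) := Finset.univ.filter fun i => m.testBit i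

def setMask (S : Finset (Fin 12)) : ℕ := ∑ i ∈ S, 2 ^ (i : ℕ)

/-- The 110 distinguished six-element subsets of the projective line over the field with eleven
elements: the orbits of the elements of order six in its projective linear group. The points are
`0, …, 10` and `11`, which stands for infinity. -/
def IsHexad (S : Finset (Fin 12)) : Bool :=
  hexadMasks.contains (setMask S) || hexadMasks.contains (4095 - setMask S)

/-- The sum of the entries of a list at the positions of the binary digits of `m`. -/
def maskSum : ℕ → List ℤ → ℤ
  | _, [] => 0
  | m, x :: l => bif m % 2 == 1 then x + maskSum (m / 2) l else maskSum (m / 2) l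

lemma maskSum_eq_sum (m : ℕ) (l : List ℤ) :
    maskSum m l = ∑ i ∈ Finset.range l.length, if m.testBit i then l.getD i 0 else 0 := by
  induction l generalizing m with
  | nil => simp [maskSum]
  | cons x l ih =>
    rw [maskSum, List.length_cons, Finset.sum_range_succ', ih]
    simp only [Nat.testBit_succ, List.getD_cons_succ, List.getD_cons_zero, Nat.testBit_zero]
    rcases Nat.mod_two_eq_zero_or_one m with h | h <;> simp [h, add_comm]

lemma maskSum_eq (m : ℕ) {l : List ℤ} (hl : l.length = 12) :
    maskSum m l = ∑ i ∈ maskSet m, l.getD (i : ℕ) 0 := by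
  rw [maskSum_eq_sum, hl, maskSet, Finset.sum_filter,
    Fin.sum_univ_eq_sum_range (fun i => if m.testBit i then l.getD i 0 else 0)]

lemma card_maskSet (m : ℕ) :
    ((maskSet m).card : ℤ) = maskSum m [1, 1, 1, 1, 1, 1, 1, 1, 1, 1, 1, 1] := by
  rw [maskSum_eq m rfl, Finset.card_eq_sum_ones, Nat.cast_sum]
  refine Finset.sum_congr rfl fun i _ => ?_
  fin_cases i <;> rfl

lemma setMask_maskSet {m : ℕ} (hm : m < 4096) : setMask (maskSet m) = m := by
  have h : ((List.range 4096).all fun m =>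
    maskSum m [1, 2, 4, 8, 16, 32, 64, 128, 256, 512, 1024, 2048] == m) = true := by decide +kernel
  have h1 := eq_of_beq (List.all_eq_true.mp h m (List.mem_range.mpr hm))
  rw [maskSum_eq m rfl] at h1
  rw [setMask]
  zify
  rw [← h1]
  refine Finset.sum_congr rfl fun i _ => ?_
  fin_cases i <;> rfl

lemma exists_maskSet (S : Finset (Fin 12)) : ∃ m < 4096, maskSet m = S := by
  have hinj : Function.Injective fun m : Fin 4096 => maskSet m := fun m n h => by
    have := congrArg setMask h
    simp only [setMask_maskSet m.2, setMask_maskSet n.2] at this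
    exact Fin.ext this
  have hsurj := ((Fintype.bijective_iff_injective_and_card _).mpr ⟨hinj, by simp⟩).2
  obtain ⟨m, hm⟩ := hsurj S
  exact ⟨m, m.2, hm⟩

def hornerMod (m x : ℤ) : List ℤ → ℤ
  | [] => 0
  | c :: l => (c + x * hornerMod m x l) % m

lemma hornerMod_modEq (m x : ℤ) (l : List ℤ) : hornerMod m x l ≡ ListPoly.eval x l [ZMOD m] := by
  induction l with
  | nil => rfl
  | cons c l ih => exact (Int.mod_modEq _ _).trans ((ih.mul_left x).add_left c)

/-- The pair is an approximate root and an approximate inverse of the derivative there; both are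
refined by Newton's method. Convergence is never proved, because the lifted roots are tested
afterwards by `liftCheck`. -/
def newtonStep (m : ℤ) (xu : ℤ × ℤ) : ℤ × ℤ :=
  let x := (xu.1 - hornerMod m xu.1 g0Coeffs * xu.2) % m
  (x, (xu.2 * (2 - hornerMod m x (ListPoly.deriv g0Coeffs) * xu.2)) % m)

def newtonLift (p : ℤ) : List ℕ → ℤ × ℤ → ℤ × ℤ
  | [], xu => xu
  | k :: ks, xu => newtonLift p ks (newtonStep (p ^ k) xu)

/-- The root of `g₀` modulo a high power of 2293 that lifts `x`. -/
def liftRoot (x : ℤ) : ℤ :=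
  -- Each exponent is at most twice the one before, as quadratic convergence allows. The starting
  -- inverse comes from Fermat's little theorem, with exponent 2293 - 2.
  (newtonLift 2293 [2, 3, 6, 11, 21, 42, 84, 168, 336, 672, 1344, 2688, 5376, 10752, 21504]
    (x, hornerMod 2293 x (ListPoly.deriv g0Coeffs) ^ 2291 % 2293)).1

def liftCheck (M : ℤ) (xs ys : List ℤ) : Bool :=
  (xs.all fun x => hornerMod M x g0Coeffs == 0) &&
  ((List.zipWith (fun x y => (x - y) % 2293 ^ 2) xs ys).all (· == 0)) &&
  (hexadMasks.all fun m => hornerMod M (((maskSum m xs - 2) ^ 2 - 374) % M) hexadResolvent == 0)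

lemma liftCheck_splitRoots :
    liftCheck (2293 ^ 21504) (splitRoots.map liftRoot) splitRoots = true := by
  decide +kernel

/-- The offset 2048 restricts attention to sets that contain the last point; this suffices, since
complementary sets give the resolvent the same value. -/
def nonHexadCheck (xs : List ℤ) : Bool :=
  (List.range 2048).all fun m =>
    let m := m + 2048
    maskSum m [1, 1, 1, 1, 1, 1, 1, 1, 1, 1, 1, 1] != 6 || hexadMasks.contains m ||
      hornerMod (2293 ^ 2) ((maskSum m xs - 2) ^ 2 - 374) hexadResolvent != 0

lemma nonHexadCheck_splitRoots : nonHexadCheck splitRoots = true := by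
  decide +kernel

/-! ### Real roots -/

/-- Hundred times points that separate the real roots of `g₀`. -/
def sepPoints (i : ℕ) : ℤ :=
  [-1025, -460, -330, -280, -240, -200, 0, 36, 38, 225, 450, 585, 1575].getD i 0

def g0Scaled : List ℤ := List.zipWith (fun c k => c * 100 ^ (12 - k)) g0Coeffs (List.range 13)

lemma eval_g0Scaled (m : ℤ) :
    ListPoly.eval ((m : ℝ) / 100) g0Coeffs * 100 ^ 12 = (ListPoly.eval m g0Scaled : ℤ) := by
  rw [← eq_intCast (Int.castRingHom ℝ) (ListPoly.eval m g0Scaled), ListPoly.map_eval]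
  simp only [g0Scaled, g0Coeffs, List.range, List.range.loop, List.zipWith, ListPoly.eval]
  simp only [eq_intCast]
  push_cast
  ring

/-- The sign of `g₀` alternates along the thirteen separating points. The enclosing intervals are
kept in the conclusion because they later bound the sums over sets of roots. -/
lemma exists_real_roots : ∃ x : Fin 12 → ℝ, Function.Injective x ∧
    (∀ i, ListPoly.eval (x i) g0Coeffs = 0) ∧
    ∀ i : Fin 12, (sepPoints i : ℝ) / 100 < x i ∧ x i < (sepPoints (i + 1) : ℝ) / 100 := by
  have hcont : Continuous fun y : ℝ => ListPoly.eval y g0Coeffs := by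
    simp only [ListPoly.eval_eq_aeval]
    exact Polynomial.continuous_aeval _
  have hsign : ∀ i : Fin 12, ListPoly.eval (sepPoints i) g0Scaled *
      ListPoly.eval (sepPoints (i + 1)) g0Scaled < 0 := by decide +kernel
  have hlt : ∀ i : Fin 12, sepPoints i < sepPoints (i + 1) := by decide +kernel
  have key : ∀ i : Fin 12, ∃ y : ℝ, ListPoly.eval y g0Coeffs = 0 ∧
      (sepPoints i : ℝ) / 100 < y ∧ y < (sepPoints (i + 1) : ℝ) / 100 := by
    intro i
    have hs : ListPoly.eval ((sepPoints i : ℝ) / 100) g0Coeffs *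
        ListPoly.eval ((sepPoints (i + 1) : ℝ) / 100) g0Coeffs < 0 := by
      have h := hsign i
      have h2 : ((ListPoly.eval (sepPoints i) g0Scaled : ℤ) : ℝ) *
        (ListPoly.eval (sepPoints (i + 1)) g0Scaled : ℤ) < 0 := by exact_mod_cast h
      rw [← eval_g0Scaled, ← eval_g0Scaled] at h2
      nlinarith
    have hle : (sepPoints i : ℝ) / 100 ≤ (sepPoints (i + 1) : ℝ) / 100 := by
      have : (sepPoints i : ℝ) ≤ sepPoints (i + 1) := by exact_mod_cast (hlt i).le
      linarith
    obtain ⟨y, hy, h0⟩ : (0 : ℝ) ∈ (fun y : ℝ => ListPoly.eval y g0Coeffs) ''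
        Set.Ioo ((sepPoints i : ℝ) / 100) ((sepPoints (i + 1) : ℝ) / 100) := by
      rcases mul_neg_iff.mp hs with ⟨h1, h2⟩ | ⟨h1, h2⟩
      · exact intermediate_value_Ioo' hle hcont.continuousOn ⟨h2, h1⟩
      · exact intermediate_value_Ioo hle hcont.continuousOn ⟨h1, h2⟩
    exact ⟨y, h0, hy.1, hy.2⟩
  choose x hx using key
  refine ⟨x, ?_, fun i => (hx i).1, fun i => (hx i).2⟩
  have hmono : ∀ i j : Fin 12, i < j → sepPoints (i + 1) ≤ sepPoints j := by decide +kernel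
  have : StrictMono x := by
    intro i j hij
    have h : (sepPoints (i + 1) : ℝ) ≤ sepPoints j := by exact_mod_cast hmono i j hij
    have := (hx i).2.2
    have := (hx j).2.1
    linarith
  exact this.injective

/-- All complex elements of the splitting field are real. -/
theorem splitting_field_real (z : ℂ) (hz : z ∈ IntermediateField.adjoin ℚ (g₀.rootSet ℂ)) :
    ∃ r : ℝ, (r : ℂ) = z := by
  obtain ⟨x, hinj, hroot, -⟩ := exists_real_roots
  have hle : IntermediateField.adjoin ℚ (g₀.rootSet ℂ) ≤
      (Complex.ofRealAm.restrictScalars ℚ).fieldRange := by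
    rw [IntermediateField.adjoin_le_iff]
    intro y hy
    have h0 : ListPoly.eval y g0Coeffs = 0 := by
      have := (mem_rootSet.mp hy).2
      rw [← g0Int_map, ← algebraMap_int_eq, aeval_map_algebraMap] at this
      rw [ListPoly.eval_eq_aeval]; exact this
    rw [eval_g0_eq_prod hinj hroot Complex.ofRealHom, Finset.prod_eq_zero_iff] at h0
    obtain ⟨i, -, hi⟩ := h0
    exact ⟨x i, (sub_eq_zero.mp hi).symm⟩
  obtain ⟨r, hr⟩ := hle hz
  exact ⟨r, hr⟩

/-! ### The resolvent at a set of points -/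

/-- The value of the resolvent at the set `S` of points, for a family `x` of twelve roots. -/
def hexadValue {R : Type*} [CommRing R] (x : Fin 12 → R) (S : Finset (Fin 12)) : R :=
  ListPoly.eval ((∑ i ∈ S, x i - 2) ^ 2 - 374) hexadResolvent

lemma map_hexadValue {R S : Type*} [CommRing R] [CommRing S] (f : R →+* S) (x : Fin 12 → R)
    (T : Finset (Fin 12)) : f (hexadValue x T) = hexadValue (fun i => f (x i)) T := by
  simp [hexadValue, ListPoly.map_eval, map_ofNat f 2, map_ofNat f 374]

/-- The two sums are `s` and `4 - s`, so `s - 2` only changes sign. -/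
lemma hexadValue_compl {R : Type*} [CommRing R] {x : Fin 12 → R} (hx : ∑ i, x i = 4)
    (S : Finset (Fin 12)) : hexadValue x Sᶜ = hexadValue x S := by
  have h := Finset.sum_compl_add_sum S x
  rw [hexadValue, hexadValue]
  congr 2
  rw [hx] at h
  linear_combination (∑ i ∈ Sᶜ, x i - ∑ i ∈ S, x i) * h

lemma sum_roots {R : Type*} [CommRing R] [IsDomain R] {r : Fin 12 → R}
    (hinj : Function.Injective r) (hr : ∀ i, ListPoly.eval (r i) g0Coeffs = 0) :
    ∑ i, r i = 4 := by
  have h1 := prod_X_sub_C_nextCoeff (s := (Finset.univ : Finset (Fin 12))) r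
  rw [← g0_eq_prod hinj hr, nextCoeff_of_natDegree_pos
    (by rw [g0Int_monic.natDegree_map, g0Int_natDegree]; norm_num),
    g0Int_monic.natDegree_map, g0Int_natDegree, coeff_map] at h1
  have h2 : g0Int.coeff 11 = -4 := by
    simp [g0Int, g0Coeffs, ListPoly.toPoly, coeff_X_mul]
  rw [show 12 - 1 = 11 from rfl, h2] at h1
  simp at h1
  linear_combination -h1

lemma abs_eval_le (y : ℝ) {B : ℕ} (hy : |y| ≤ B) (l : List ℤ) :
    |ListPoly.eval y l| ≤ (ListPoly.eval (B : ℤ) (l.map fun c => |c|) : ℤ) := by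
  induction l with
  | nil => simp
  | cons c l ih =>
    simp only [ListPoly.eval, List.map_cons]
    push_cast
    refine (abs_add_le _ _).trans (add_le_add le_rfl ?_)
    rw [abs_mul]
    exact mul_le_mul hy ih (abs_nonneg _) (by positivity)

def hexadBound : ℤ := ListPoly.eval (375 : ℤ) (hexadResolvent.map fun c => |c|)

/-- The intervals around the real roots confine every partial sum of the roots, hence the argument
of the resolvent; the triangle inequality on the coefficients does the rest. -/
lemma abs_hexadValue_le {x : Fin 12 → ℝ} (hinj : Function.Injective x)
    (hx : ∀ i, ListPoly.eval (x i) g0Coeffs = 0) (S : Finset (Fin 12)) :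
    |hexadValue x S| ≤ hexadBound := by
  obtain ⟨y, hyinj, hyroot, hy⟩ := exists_real_roots
  have hex : ∀ i, ∃ j, x i = y j := by
    intro i
    have := hx i
    rw [eval_g0_eq_prod hyinj hyroot (RingHom.id ℝ), Finset.prod_eq_zero_iff] at this
    obtain ⟨j, -, hj⟩ := this
    exact ⟨j, sub_eq_zero.mp hj⟩
  choose π hπ using hex
  have hπinj : Function.Injective π := fun i j h => hinj (by rw [hπ, hπ, h])
  have hsum : ∑ i ∈ S, x i = ∑ j ∈ S.map ⟨π, hπinj⟩, y j := by
    rw [Finset.sum_map]; exact Finset.sum_congr rfl fun i _ => hπ i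
  -- 29.09 is the sum of the positive right endpoints; the lower bound -25.35 below is the sum of
  -- the negative left endpoints.
  have hup : ∑ i ∈ S, x i ≤ 2909 / 100 := by
    rw [hsum]
    calc ∑ j ∈ S.map ⟨π, hπinj⟩, y j
        ≤ ∑ j ∈ S.map ⟨π, hπinj⟩, ((max (sepPoints (j + 1)) 0 : ℤ) : ℝ) / 100 := by
          refine Finset.sum_le_sum fun j _ => (hy j).2.le.trans ?_
          have : (sepPoints (j + 1) : ℝ) ≤ ((max (sepPoints (j + 1)) 0 : ℤ) : ℝ) := by
            exact_mod_cast le_max_left _ _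
          linarith
      _ ≤ ∑ j : Fin 12, ((max (sepPoints (j + 1)) 0 : ℤ) : ℝ) / 100 :=
          Finset.sum_le_sum_of_subset_of_nonneg (Finset.subset_univ _) fun j _ _ => by
            have : (0 : ℝ) ≤ ((max (sepPoints (j + 1)) 0 : ℤ) : ℝ) := by
              exact_mod_cast le_max_right _ _
            linarith
      _ = 2909 / 100 := by
          rw [← Finset.sum_div, ← Int.cast_sum,
            show ∑ j : Fin 12, max (sepPoints (j + 1)) 0 = 2909 by decide +kernel]
          norm_num
  have hlow : -(2535 / 100) ≤ ∑ i ∈ S, x i := by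
    rw [hsum]
    calc ∑ j ∈ S.map ⟨π, hπinj⟩, y j
        ≥ ∑ j ∈ S.map ⟨π, hπinj⟩, ((min (sepPoints j) 0 : ℤ) : ℝ) / 100 := by
          refine Finset.sum_le_sum fun j _ => le_trans ?_ (hy j).1.le
          have : ((min (sepPoints j) 0 : ℤ) : ℝ) ≤ (sepPoints j : ℝ) := by
            exact_mod_cast min_le_left _ _
          linarith
      _ ≥ ∑ j : Fin 12, ((min (sepPoints j) 0 : ℤ) : ℝ) / 100 := by
          have := Finset.sum_le_sum_of_subset_of_nonneg
            (f := fun j : Fin 12 => -(((min (sepPoints j) 0 : ℤ) : ℝ) / 100))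
            (Finset.subset_univ (S.map ⟨π, hπinj⟩)) fun j _ _ => by
              have : ((min (sepPoints j) 0 : ℤ) : ℝ) ≤ 0 := by exact_mod_cast min_le_right _ _
              linarith
          simp only [Finset.sum_neg_distrib] at this
          linarith
      _ = -(2535 / 100) := by
          rw [← Finset.sum_div, ← Int.cast_sum,
            show ∑ j : Fin 12, min (sepPoints j) 0 = -2535 by decide +kernel]
          norm_num
  -- Here `s - 2` lies between -27.35 and 27.09, so its square lies between 0 and 748.03.
  -- Subtracting 374 centres this range, which keeps the bound small.
  refine abs_eval_le _ (B := 375) ?_ _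
  rw [abs_le]
  push_cast
  constructor <;> nlinarith

lemma eval_modEq {m x y : ℤ} (h : x ≡ y [ZMOD m]) (l : List ℤ) :
    ListPoly.eval x l ≡ ListPoly.eval y l [ZMOD m] := by
  induction l with
  | nil => rfl
  | cons c l ih => exact (h.mul ih).add_left _

/-- The approximate root with a given label. -/
def splitRoot (i : Fin 12) : ℤ := splitRoots.getD i 0

lemma liftCheck_spec {M : ℤ} {xs : List ℤ} (hlen : xs.length = 12)
    (h : liftCheck M xs splitRoots = true) :
    (∀ i : Fin 12, M ∣ ListPoly.eval (xs.getD i 0) g0Coeffs) ∧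
    (∀ i : Fin 12, 2293 ^ 2 ∣ xs.getD i 0 - splitRoot i) ∧
    ∀ m ∈ hexadMasks, M ∣ hexadValue (fun i : Fin 12 => xs.getD i 0) (maskSet m) := by
  simp only [liftCheck, Bool.and_eq_true, List.all_eq_true, beq_iff_eq] at h
  obtain ⟨⟨h1, h2⟩, h3⟩ := h
  refine ⟨fun i => ?_, fun i => ?_, fun m hm => ?_⟩
  · have hi : (i : ℕ) < xs.length := by omega
    have := h1 _ (List.getElem_mem hi)
    rw [List.getD_eq_getElem _ _ hi]
    refine Int.modEq_zero_iff_dvd.mp ((hornerMod_modEq M _ _).symm.trans ?_)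
    rw [this]
  · have hi : (i : ℕ) < xs.length := by omega
    have hi' : (i : ℕ) < splitRoots.length := i.2
    have hz : (i : ℕ) < (List.zipWith (fun x y => (x - y) % 2293 ^ 2) xs splitRoots).length := by
      rw [List.length_zipWith]; exact lt_min hi hi'
    have := h2 _ (List.getElem_mem hz)
    rw [List.getElem_zipWith] at this
    rw [splitRoot, List.getD_eq_getElem _ _ hi, List.getD_eq_getElem _ _ hi']
    exact Int.dvd_of_emod_eq_zero this
  · have := h3 m hm
    rw [hexadValue, ← maskSum_eq m hlen]
    refine Int.modEq_zero_iff_dvd.mp ((eval_modEq (Int.mod_modEq _ M).symm _).trans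
      ((hornerMod_modEq M _ _).symm.trans ?_))
    rw [this]

lemma exists_lifts : ∃ a : Fin 12 → ℤ, (∀ i, 2293 ^ 21504 ∣ ListPoly.eval (a i) g0Coeffs) ∧
    (∀ i, 2293 ^ 2 ∣ a i - splitRoot i) ∧
    ∀ m ∈ hexadMasks, 2293 ^ 21504 ∣ hexadValue a (maskSet m) := by
  obtain ⟨h1, h2, h3⟩ := liftCheck_spec (by rw [List.length_map]; rfl) liftCheck_splitRoots
  exact ⟨_, h1, h2, h3⟩

lemma mem_hexadMasks_of_dvd {m : ℕ} (hm : 2048 ≤ m) (hm' : m < 4096)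
    (hcard : (maskSet m).card = 6) (h : 2293 ^ 2 ∣ hexadValue splitRoot (maskSet m)) :
    m ∈ hexadMasks := by
  have := List.all_eq_true.mp nonHexadCheck_splitRoots (m - 2048) (List.mem_range.mpr (by omega))
  rw [← Nat.cast_inj (R := ℤ), card_maskSet] at hcard
  simp only [show m - 2048 + 2048 = m by omega, hcard] at this
  rw [hexadValue, show ∑ i ∈ maskSet m, splitRoot i = maskSum m splitRoots from
    (maskSum_eq m rfl).symm] at h
  have h0 := (hornerMod_modEq (2293 ^ 2) ((maskSum m splitRoots - 2) ^ 2 - 374)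
    hexadResolvent).trans (Int.modEq_zero_iff_dvd.mpr h)
  have h1 : hornerMod (2293 ^ 2) ((maskSum m splitRoots - 2) ^ 2 - 374) hexadResolvent = 0 := by
    rw [Int.ModEq, Int.zero_emod] at h0
    rw [← h0]
    simp only [hexadResolvent, hornerMod, Int.emod_emod]
  rw [h1] at this
  simpa using this

/-! ### Roots in the 2293-adic integers -/

instance fact_prime_2293 : Fact (Nat.Prime 2293) := ⟨by norm_num⟩

/-- Hensel's lemma with a quantitative bound, for simple roots. -/
lemma exists_padic_root {p : ℕ} [Fact p.Prime] {f : ℤ[X]} {a : ℤ} {n : ℕ} (hn : n ≠ 0)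
    (hf : (p : ℤ) ^ n ∣ aeval a f) (hd : ¬ (p : ℤ) ∣ aeval a (derivative f)) :
    ∃ z : ℤ_[p], aeval z f = 0 ∧ (p : ℤ_[p]) ^ n ∣ z - a := by
  have hcast : ∀ g : ℤ[X], aeval (a : ℤ_[p]) g = ((aeval a g : ℤ) : ℤ_[p]) := fun g => by
    rw [← eq_intCast (algebraMap ℤ ℤ_[p]) a, aeval_algebraMap_apply]; simp
  have hd1 : ‖aeval (a : ℤ_[p]) (derivative f)‖ = 1 := by
    rw [hcast]
    refine le_antisymm (PadicInt.norm_le_one _) (not_lt.mp fun h => hd ?_)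
    exact PadicInt.norm_int_lt_one_iff_dvd _ |>.mp h
  have hfa : ‖aeval (a : ℤ_[p]) f‖ ≤ (p : ℝ) ^ (-(n : ℤ)) := by
    rw [hcast]; exact PadicInt.norm_int_le_pow_iff_dvd.mpr (by exact_mod_cast hf)
  have hp1 : (1 : ℝ) < p := by exact_mod_cast (Fact.out : p.Prime).one_lt
  have hlt : ‖aeval (a : ℤ_[p]) f‖ < 1 := by
    refine hfa.trans_lt ?_
    rw [zpow_neg, zpow_natCast]
    exact inv_lt_one_of_one_lt₀ (one_lt_pow₀ hp1 hn)
  obtain ⟨z, hz, hza, -, -⟩ := hensels_lemma (F := f) (a := (a : ℤ_[p]))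
    (by rw [hd1]; simpa using hlt)
  refine ⟨z, hz, ?_⟩
  rw [hd1] at hza
  -- Expanding at `a` gives `0 = f(a) + (z - a) (f'(a) + k (z - a))`. The last factor is a unit, so
  -- `z - a` and `f(a)` have the same norm.
  obtain ⟨k, hk⟩ := (f.map (algebraMap ℤ ℤ_[p])).binomExpansion (a : ℤ_[p]) (z - a)
  rw [add_sub_cancel, eval_map_algebraMap, eval_map_algebraMap, derivative_map,
    eval_map_algebraMap, hz] at hk
  have hprod : aeval (a : ℤ_[p]) f =
      -((z - a) * (aeval (a : ℤ_[p]) (derivative f) + k * (z - a))) := by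
    linear_combination -hk
  have hunit : ‖aeval (a : ℤ_[p]) (derivative f) + k * (z - a)‖ = 1 := by
    have hlt1 : ‖k * (z - a)‖ < 1 := by
      rw [norm_mul]
      exact (mul_le_of_le_one_left (norm_nonneg _) (PadicInt.norm_le_one k)).trans_lt hza
    rw [PadicInt.norm_add_eq_max_of_ne (by rw [hd1]; exact hlt1.ne'), hd1, max_eq_left hlt1.le]
  have hnorm : ‖z - a‖ = ‖aeval (a : ℤ_[p]) f‖ := by
    rw [hprod, norm_neg, norm_mul, hunit, mul_one]
  rw [← Ideal.mem_span_singleton, ← PadicInt.norm_le_pow_iff_mem_span_pow, hnorm]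
  exact hfa

lemma splitRoot_deriv : ∀ i,
    ¬ (2293 : ℤ) ∣ ListPoly.eval (splitRoot i) (ListPoly.deriv g0Coeffs) := by
  decide +kernel

lemma splitRoot_ne : ∀ i j, i ≠ j → ¬ (2293 : ℤ) ∣ splitRoot i - splitRoot j := by
  decide +kernel

lemma hexadValue_sub_dvd {R : Type*} [CommRing R] {d : R} {x y : Fin 12 → R}
    (h : ∀ i, d ∣ x i - y i) (S : Finset (Fin 12)) : d ∣ hexadValue x S - hexadValue y S := by
  rw [← Ideal.mem_span_singleton, ← Ideal.Quotient.eq, map_hexadValue, map_hexadValue]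
  congr 1
  funext i
  exact Ideal.Quotient.eq.mpr (Ideal.mem_span_singleton.mpr (h i))

lemma hexadValue_intCast {R : Type*} [CommRing R] (a : Fin 12 → ℤ) (S : Finset (Fin 12)) :
    ((hexadValue a S : ℤ) : R) = hexadValue (fun i => (a i : R)) S :=
  map_hexadValue (Int.castRingHom R) a S

/-- All twelve roots lie in the 2293-adic integers, and their order in `splitRoots` labels them by
points of the projective line. High precision serves the vanishing at hexads; precision two serves
the non-vanishing elsewhere. -/
theorem exists_padic_roots : ∃ z : Fin 12 → ℤ_[2293], Function.Injective z ∧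
    (∀ i, ListPoly.eval (z i) g0Coeffs = 0) ∧
    (∀ m ∈ hexadMasks, (2293 : ℤ_[2293]) ^ 21504 ∣ hexadValue z (maskSet m)) ∧
    ∀ S, (2293 : ℤ_[2293]) ^ 2 ∣ hexadValue z S - (hexadValue splitRoot S : ℤ) := by
  obtain ⟨a, ha, haρ, hhex⟩ := exists_lifts
  have hdvd : ∀ i, (2293 : ℤ) ∣ a i - splitRoot i := fun i =>
    (dvd_pow_self _ two_ne_zero).trans (haρ i)
  have hz : ∀ i, ∃ z : ℤ_[2293], ListPoly.eval z g0Coeffs = 0 ∧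
      (2293 : ℤ_[2293]) ^ 21504 ∣ z - a i := by
    intro i
    obtain ⟨z, h0, h1⟩ := exists_padic_root (p := 2293) (f := g0Int) (a := a i) (n := 21504)
      (by norm_num) (by rw [g0Int, ← ListPoly.eval_eq_aeval]; exact ha i) (by
        rw [g0Int, ListPoly.derivative_toPoly, ← ListPoly.eval_eq_aeval]
        intro h
        apply splitRoot_deriv i
        have := (eval_modEq ((Int.modEq_iff_dvd.mpr (hdvd i))) (ListPoly.deriv g0Coeffs))
        exact Int.modEq_zero_iff_dvd.mp (this.trans (Int.modEq_zero_iff_dvd.mpr h)))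
    exact ⟨z, by rw [ListPoly.eval_eq_aeval]; exact h0, by exact_mod_cast h1⟩
  choose z h0 h1 using hz
  have hpow : (2293 : ℤ_[2293]) ^ 2 ∣ 2293 ^ 21504 := pow_dvd_pow _ (by norm_num)
  have h2 : ∀ i, (2293 : ℤ_[2293]) ^ 2 ∣ z i - (splitRoot i : ℤ) := fun i => by
    have h3 : ((2293 ^ 2 : ℤ) : ℤ_[2293]) ∣ ((a i - splitRoot i : ℤ) : ℤ_[2293]) :=
      map_dvd (Int.castRingHom _) (haρ i)
    push_cast at h3
    have := dvd_add (hpow.trans (h1 i)) h3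
    rwa [sub_add_sub_cancel] at this
  refine ⟨z, fun i j hij => ?_, h0, fun m hm => ?_, fun S => ?_⟩
  · by_contra hne
    apply splitRoot_ne i j hne
    have h3 := dvd_sub (h2 j) (h2 i)
    rw [hij, sub_sub_sub_cancel_left] at h3
    have h4 : (2293 : ℤ_[2293]) ∣ ((splitRoot i - splitRoot j : ℤ) : ℤ_[2293]) := by
      push_cast; exact (dvd_pow_self _ two_ne_zero).trans h3
    refine (PadicInt.norm_int_lt_one_iff_dvd (p := 2293) _).mp ?_
    obtain ⟨c, hc⟩ := h4
    rw [hc, norm_mul]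
    have : ‖(2293 : ℤ_[2293])‖ < 1 := by
      have := (PadicInt.norm_int_lt_one_iff_dvd (p := 2293) 2293).mpr dvd_rfl
      exact_mod_cast this
    exact (mul_le_of_le_one_right (norm_nonneg _) (PadicInt.norm_le_one c)).trans_lt this
  · have h3 := hexadValue_sub_dvd h1 (maskSet m)
    rw [← hexadValue_intCast] at h3
    have h4 : ((2293 ^ 21504 : ℤ) : ℤ_[2293]) ∣ ((hexadValue a (maskSet m) : ℤ) : ℤ_[2293]) :=
      map_dvd (Int.castRingHom _) (hhex m hm)
    rw [Int.cast_pow, Int.cast_ofNat] at h4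
    have := dvd_add h3 h4
    rwa [sub_add_cancel] at this
  · have h3 := hexadValue_sub_dvd h2 S
    rwa [← hexadValue_intCast] at h3

/-! ### Numbered roots in the splitting field and the zeros of the resolvent -/

lemma map_g0 (K : Type*) [Field K] [Algebra ℚ K] :
    g₀.map (algebraMap ℚ K) = g0Int.map (Int.castRingHom K) := by
  rw [← g0Int_map, Polynomial.map_map]
  congr 1
  exact RingHom.ext_int _ _

lemma eval₂_map_g0 {R S : Type*} [CommRing R] [CommRing S] (f : R →+* S) (x : S) :
    eval₂ f x (g0Int.map (Int.castRingHom R)) = ListPoly.eval x g0Coeffs := by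
  rw [eval₂_map, ListPoly.eval_eq_aeval, aeval_def, g0Int]
  congr 1
  exact RingHom.ext_int _ _

lemma splits_of_roots {K : Type*} [Field K] [Algebra ℚ K] {x : Fin 12 → K}
    (hinj : Function.Injective x) (hx : ∀ i, ListPoly.eval (x i) g0Coeffs = 0) :
    (g₀.map (algebraMap ℚ K)).Splits := by
  rw [map_g0, g0_eq_prod hinj hx]
  exact Splits.prod fun i _ => Splits.X_sub_C _

/-- An embedding of the splitting field, with the roots numbered by their images. -/
lemma exists_numbering (L : Type*) [Field L] [NumberField L] [IsSplittingField ℚ L g₀]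
    {K : Type*} [Field K] [Algebra ℚ K] {x : Fin 12 → K}
    (hinj : Function.Injective x) (hx : ∀ i, ListPoly.eval (x i) g0Coeffs = 0) :
    ∃ (f : L →ₐ[ℚ] K) (r : Fin 12 → 𝓞 L),
      Function.Injective r ∧ (∀ i, ListPoly.eval (r i) g0Coeffs = 0) ∧
      ∀ i, f (r i : L) = x i := by
  obtain ⟨f⟩ : Nonempty (L →ₐ[ℚ] K) :=
    ⟨IsSplittingField.lift L g₀ (splits_of_roots hinj hx)⟩
  have hex : ∀ i, ∃ y : 𝓞 L, ListPoly.eval y g0Coeffs = 0 ∧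
      f (y : L) = x i := by
    intro i
    have hs : (g₀.map (algebraMap ℚ L)).Splits := IsSplittingField.splits L g₀
    have hm : (g₀.map (algebraMap ℚ L)).Monic := by
      rw [map_g0]; exact g0Int_monic.map _
    -- Evaluating the factorization over `L` at `x i` through `f` makes the product of the
    -- differences `x i - f y` vanish, so `x i` is the image of a root `y`.
    have hprod := hs.eq_prod_roots_of_monic hm
    have h0 := congrArg (eval₂ (f : L →+* K) (x i)) hprod
    have hl : eval₂ (f : L →+* K) (x i)
        (g₀.map (algebraMap ℚ L)) = 0 := by
      rw [map_g0, eval₂_map_g0, hx]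
    rw [hl, eval₂_multiset_prod, Multiset.map_map, eq_comm, Multiset.prod_eq_zero_iff,
      Multiset.mem_map] at h0
    obtain ⟨y, hy, hy0⟩ := h0
    simp only [Function.comp_apply, eval₂_sub, eval₂_X, eval₂_C] at hy0
    have hyr : ListPoly.eval y g0Coeffs = 0 := by
      have := (mem_roots hm.ne_zero).mp hy
      rwa [IsRoot, map_g0, ← eval₂_id, eval₂_map_g0] at this
    have hint : IsIntegral ℤ y := ⟨g0Int, g0Int_monic, by
      rw [← aeval_def, g0Int, ← ListPoly.eval_eq_aeval]; exact hyr⟩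
    obtain ⟨y, rfl⟩ : ∃ y' : 𝓞 L, (y' : L) = y := ⟨⟨y, hint⟩, rfl⟩
    refine ⟨y, RingOfIntegers.ext ?_, (sub_eq_zero.mp hy0).symm⟩
    exact ((ListPoly.map_eval (algebraMap (𝓞 L) L) y g0Coeffs).trans hyr).trans
      (map_zero (algebraMap (𝓞 L) L)).symm
  choose r hr hf using hex
  exact ⟨f, r, fun i j h => hinj (by rw [← hf, ← hf, h]), hr, hf⟩

section
variable {L : Type*} [Field L] [NumberField L] [IsGalois ℚ L] {r : Fin 12 → 𝓞 L}

omit [IsGalois ℚ L] in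
/-- The permutation of the labels of the roots induced by an automorphism. -/
lemma exists_perm (hinj : Function.Injective r) (hr : ∀ i, ListPoly.eval (r i) g0Coeffs = 0)
    (σ : L ≃ₐ[ℚ] L) : ∃ π : Equiv.Perm (Fin 12), ∀ i, σ • r i = r (π i) := by
  have hex : ∀ i, ∃ j, σ • r i = r j := fun i =>
    exists_eq_of_eval_g0 hinj hr (by rw [listEval_smul, hr, smul_zero])
  choose π hπ using hex
  have hπinj : Function.Injective π := fun i j h => hinj (by
    have : σ • r i = σ • r j := by rw [hπ, hπ, h]
    exact smul_left_cancel σ this)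
  exact ⟨Equiv.ofBijective π (Finite.injective_iff_bijective.mp hπinj), hπ⟩

omit [IsGalois ℚ L] in
lemma smul_hexadValue {σ : L ≃ₐ[ℚ] L} {π : Equiv.Perm (Fin 12)} (h : ∀ i, σ • r i = r (π i))
    (S : Finset (Fin 12)) : σ • hexadValue r S = hexadValue r (S.map π.toEmbedding) := by
  have h1 := map_hexadValue (MulSemiringAction.toRingHom (L ≃ₐ[ℚ] L) (𝓞 L) σ) r S
  refine h1.trans ?_
  simp only [MulSemiringAction.toRingHom_apply, h, hexadValue, Finset.sum_map]
  rfl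

/-- A resolvent value that is divisible by a high power of a prime, all of whose conjugates are
bounded, is zero. -/
lemma hexadValue_eq_zero (hinj : Function.Injective r)
    (hr : ∀ i, ListPoly.eval (r i) g0Coeffs = 0) {p : ℕ} [Fact p.Prime]
    (ι : L →+* ℚ_[p]) (j : L →+* ℝ) {z : Fin 12 → ℤ_[p]} (hz : ∀ i, ι (r i : L) = z i)
    {N : ℕ} {B : ℕ} (hB : ∀ S, |j (hexadValue r S : 𝓞 L)| ≤ B) (hB1 : 1 ≤ B)
    (hBN : B ^ 462 < p ^ N) {S : Finset (Fin 12)} (hS : S.card = 6)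
    (hdvd : (p : ℤ_[p]) ^ N ∣ hexadValue z S) : hexadValue r S = 0 := by
  classical
  have := Fintype.ofFinite (L ≃ₐ[ℚ] L)
  set v := hexadValue r S with hv
  set O : Finset (𝓞 L) := Finset.univ.image fun σ : L ≃ₐ[ℚ] L => σ • v with hO
  have hOval : ∀ w ∈ O, ∃ T : Finset (Fin 12), T.card = 6 ∧ w = hexadValue r T := by
    intro w hw
    obtain ⟨σ, -, rfl⟩ := Finset.mem_image.mp hw
    obtain ⟨π, hπ⟩ := exists_perm hinj hr σ
    exact ⟨S.map π.toEmbedding, by rw [Finset.card_map, hS], smul_hexadValue hπ S⟩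
  -- By complementation every conjugate is a value at a six-set through the point 0, and there are
  -- $\binom{11}{5}=462$ of these.
  have hcard : O.card ≤ 462 := by
    have hsub : O ⊆ (((Finset.univ : Finset (Fin 12)).erase 0).powersetCard 5).image
        fun T => hexadValue r (insert 0 T) := by
      intro w hw
      obtain ⟨T, hT, rfl⟩ := hOval w hw
      have key : ∀ U : Finset (Fin 12), U.card = 6 → 0 ∈ U → hexadValue r U ∈
          (((Finset.univ : Finset (Fin 12)).erase 0).powersetCard 5).image
            fun T => hexadValue r (insert 0 T) := by
        intro U hU h0
        refine Finset.mem_image.mpr ⟨U.erase 0, Finset.mem_powersetCard.mpr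
          ⟨Finset.erase_subset_erase 0 (Finset.subset_univ U), ?_⟩, ?_⟩
        · rw [Finset.card_erase_of_mem h0, hU]
        · rw [Finset.insert_erase h0]
      by_cases h0 : 0 ∈ T
      · exact key T hT h0
      · rw [← hexadValue_compl (sum_roots hinj hr)]
        exact key _ (by rw [Finset.card_compl, hT]; rfl) (Finset.mem_compl.mpr h0)
    refine (Finset.card_le_card hsub).trans (Finset.card_image_le.trans ?_)
    rw [Finset.card_powersetCard, Finset.card_erase_of_mem (Finset.mem_univ _)]
    decide
  have hinv : ∀ τ : L ≃ₐ[ℚ] L, τ • ∏ w ∈ O, w = ∏ w ∈ O, w := by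
    intro τ
    rw [Finset.smul_prod']
    refine Finset.prod_bij (fun w _ => τ • w) ?_ (fun _ _ _ _ h => smul_left_cancel τ h) ?_
      (fun _ _ => rfl)
    · intro w hw
      obtain ⟨σ, -, rfl⟩ := Finset.mem_image.mp hw
      exact Finset.mem_image.mpr ⟨τ * σ, Finset.mem_univ _, mul_smul _ _ _⟩
    · intro w hw
      obtain ⟨σ, -, rfl⟩ := Finset.mem_image.mp hw
      exact ⟨(τ⁻¹ * σ) • v, Finset.mem_image.mpr ⟨τ⁻¹ * σ, Finset.mem_univ _, rfl⟩, by
        rw [smul_smul, mul_inv_cancel_left]⟩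
  -- The product over the distinct conjugates is Galois invariant, hence a rational integer `n`.
  obtain ⟨n, hn⟩ := Algebra.IsInvariant.isInvariant (A := ℤ) (G := L ≃ₐ[ℚ] L) _ hinv
  have hvO : v ∈ O := Finset.mem_image.mpr ⟨1, Finset.mem_univ _, one_smul _ _⟩
  have hnL : (n : L) = ∏ w ∈ O, (w : L) := by
    have := congrArg (algebraMap (𝓞 L) L) hn
    rw [map_prod] at this
    rw [← this]; simp
  have hιval : ∀ T, ι (hexadValue r T : 𝓞 L) = (hexadValue z T : ℤ_[p]) := by
    intro T
    have h1 := map_hexadValue (ι.comp (algebraMap (𝓞 L) L)) r T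
    have h2 := map_hexadValue (PadicInt.Coe.ringHom (p := p)) z T
    refine h1.trans (Eq.trans ?_ h2.symm)
    congr 1
    funext i
    exact hz i
  -- The factor `v` carries the power of `p`; the other conjugates are values at sets of roots too,
  -- hence `p`-adic integers.
  have hpn : (p : ℤ) ^ N ∣ n := by
    have := (PadicInt.norm_int_le_pow_iff_dvd (p := p) (k := n) (n := N)).mp ?_
    · exact_mod_cast this
    have h1 : ‖((n : ℤ_[p]) : ℚ_[p])‖ = ∏ w ∈ O, ‖ι (w : L)‖ := by
      have := congrArg ι hnL
      rw [map_prod, map_intCast] at this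
      rw [PadicInt.coe_intCast, this, norm_prod]
    rw [PadicInt.norm_def, h1, ← Finset.mul_prod_erase _ _ hvO]
    have h2 : ‖ι (v : L)‖ ≤ (p : ℝ) ^ (-(N : ℤ)) := by
      rw [hv, hιval, ← PadicInt.norm_def, PadicInt.norm_le_pow_iff_mem_span_pow,
        Ideal.mem_span_singleton]
      exact hdvd
    refine (mul_le_of_le_one_right (norm_nonneg _) ?_).trans h2
    refine Finset.prod_le_one (fun _ _ => norm_nonneg _) fun w hw => ?_
    obtain ⟨T, -, rfl⟩ := hOval w (Finset.mem_of_mem_erase hw)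
    rw [hιval, ← PadicInt.norm_def]
    exact PadicInt.norm_le_one _
  have hnB : |(n : ℝ)| ≤ (B : ℝ) ^ 462 := by
    have h1 := congrArg j hnL
    rw [map_prod, map_intCast] at h1
    rw [h1, Finset.abs_prod]
    calc ∏ w ∈ O, |j (w : L)| ≤ ∏ _w ∈ O, (B : ℝ) := by
          refine Finset.prod_le_prod (fun _ _ => abs_nonneg _) fun w hw => ?_
          obtain ⟨T, -, rfl⟩ := hOval w hw
          exact hB T
      _ = (B : ℝ) ^ O.card := by rw [Finset.prod_const]
      _ ≤ (B : ℝ) ^ 462 := pow_le_pow_right₀ (by exact_mod_cast hB1) hcard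
  have hn0 : n = 0 := by
    refine Int.eq_zero_of_abs_lt_dvd hpn ?_
    have h1 : |n| ≤ (B : ℤ) ^ 462 := by exact_mod_cast hnB
    exact h1.trans_lt (by exact_mod_cast hBN)
  -- Some conjugate vanishes, hence so does `v`.
  rw [hn0, map_zero, eq_comm, Finset.prod_eq_zero_iff] at hn
  obtain ⟨w, hw, rfl⟩ := hn
  obtain ⟨σ, -, hσ⟩ := Finset.mem_image.mp hw
  exact (smul_eq_zero_iff_eq σ).mp hσ

end

/-- The lifting exponent has to be large enough for this inequality. -/
lemma hexadBound_pow_lt : hexadBound.toNat ^ 462 < 2293 ^ 21504 := by decide +kernel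

/-- The roots can be labelled so that the resolvent vanishes exactly at the hexads. -/
theorem exists_hexad_numbering (L : Type*) [Field L] [NumberField L]
    [IsSplittingField ℚ L g₀] : ∃ r : Fin 12 → 𝓞 L, Function.Injective r ∧
    (∀ i, ListPoly.eval (r i) g0Coeffs = 0) ∧
    ∀ S : Finset (Fin 12), S.card = 6 → (hexadValue r S = 0 ↔ IsHexad S = true) := by
  obtain ⟨z, hzinj, hz, hzero, hmod⟩ := exists_padic_roots
  have hzinj' : Function.Injective fun i => (z i : ℚ_[2293]) := fun i j h =>
    hzinj (PadicInt.ext h)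
  obtain ⟨ι, r, hinj, hr, hι⟩ := exists_numbering L (K := ℚ_[2293]) hzinj' (fun i => by
    have := ListPoly.map_eval (PadicInt.Coe.ringHom (p := 2293)) (z i) g0Coeffs
    rw [hz, map_zero] at this
    exact this.symm)
  obtain ⟨x, hxinj, hx, -⟩ := exists_real_roots
  let j := IsSplittingField.lift L g₀ (splits_of_roots hxinj hx)
  have hgal : IsGalois ℚ L :=
    IsGalois.of_separable_splitting_field (p := g₀) g0_irreducible.separable
  have hsum := sum_roots hinj hr
  -- Exactly one of `S` and its complement contains the last point, and the tables list only such
  -- sets.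
  have hmask : ∀ S : Finset (Fin 12), ∃ m, 2048 ≤ m ∧ m < 4096 ∧
      (maskSet m = S ∨ maskSet m = Sᶜ) ∧ (IsHexad S = true ↔ m ∈ hexadMasks) := by
    have hlow : ∀ m ∈ hexadMasks, 2048 ≤ m := by decide +kernel
    intro S
    obtain ⟨m, hm, rfl⟩ := exists_maskSet S
    have hcompl : (maskSet m)ᶜ = maskSet (4095 - m) := by
      ext i
      simp only [maskSet, Finset.mem_compl, Finset.mem_filter, Finset.mem_univ, true_and]
      rw [show 4095 - m = 2 ^ 12 - (m + 1) by omega, Nat.testBit_two_pow_sub_succ (by omega)]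
      simp
    simp only [IsHexad, setMask_maskSet hm, Bool.or_eq_true, List.contains_iff_mem]
    by_cases h : 2048 ≤ m
    · exact ⟨m, h, hm, Or.inl rfl, fun h1 => h1.resolve_right fun h2 => by
        have := hlow _ h2; omega, Or.inl⟩
    · exact ⟨4095 - m, by omega, by omega, Or.inr hcompl.symm, fun h1 => h1.resolve_left fun h2 => by
        have := hlow _ h2; omega, Or.inr⟩
  refine ⟨r, hinj, hr, fun S hS => ?_⟩
  obtain ⟨m, hm, hm', hmS, hiff⟩ := hmask S
  have hval : hexadValue r S = hexadValue r (maskSet m) := by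
    rcases hmS with h | h
    · rw [h]
    · rw [h, hexadValue_compl hsum]
  have hcard : (maskSet m).card = 6 := by
    rcases hmS with h | h
    · rw [h, hS]
    · rw [h, Finset.card_compl, hS]; rfl
  rw [hval, hiff]
  constructor
  -- A zero in `L` maps to a 2293-adic zero, so the resolvent at the approximate roots is divisible
  -- by $2293^2$, which the table permits only at hexads.
  · intro h0
    have h1 := map_hexadValue ((ι : L →+* ℚ_[2293]).comp
      (algebraMap (𝓞 L) L)) r (maskSet m)
    have h2 := map_hexadValue (PadicInt.Coe.ringHom (p := 2293)) z (maskSet m)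
    rw [h0, map_zero, show (fun i => ((ι : L →+* ℚ_[2293]).comp
      (algebraMap (𝓞 L) L)) (r i)) =
      fun i => PadicInt.Coe.ringHom (z i) from funext hι, ← h2] at h1
    have h3 : hexadValue z (maskSet m) = 0 := PadicInt.ext h1.symm
    have h4 := hmod (maskSet m)
    rw [h3, zero_sub, dvd_neg] at h4
    refine mem_hexadMasks_of_dvd hm hm' hcard ?_
    have h5 := (PadicInt.norm_int_le_pow_iff_dvd (p := 2293)
      (k := hexadValue splitRoot (maskSet m)) (n := 2)).mp (by
        rw [PadicInt.norm_le_pow_iff_mem_span_pow, Ideal.mem_span_singleton]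
        exact_mod_cast h4)
    exact_mod_cast h5
  · intro hmem
    refine hexadValue_eq_zero hinj hr (p := 2293) (ι : L →+* ℚ_[2293])
      (j : L →+* ℝ) (z := z) hι (N := 21504) (B := hexadBound.toNat) ?_ ?_
      hexadBound_pow_lt hcard (by exact_mod_cast hzero m hmem)
    · intro S
      have h1 := map_hexadValue ((j : L →+* ℝ).comp
        (algebraMap (𝓞 L) L)) r S
      have hb : ((hexadBound.toNat : ℕ) : ℝ) = (hexadBound : ℤ) := by
        have : ((hexadBound.toNat : ℕ) : ℤ) = hexadBound :=
          Int.toNat_of_nonneg (by decide +kernel)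
        exact_mod_cast this
      rw [hb]
      refine (congrArg abs h1).le.trans (abs_hexadValue_le ?_ ?_ S)
      · intro a b hab
        apply hinj
        apply RingOfIntegers.ext
        exact (j : L →+* ℝ).injective hab
      · intro i
        have := ListPoly.map_eval ((j : L →+* ℝ).comp
          (algebraMap (𝓞 L) L)) (r i) g0Coeffs
        rw [hr, map_zero] at this
        exact this.symm
    · decide +kernel

/-! ### Permutations of the projective line that preserve the hexads -/

/-- Bit masks of all hexads. -/
def allHexadMasks : List ℕ := hexadMasks ++ hexadMasks.map (4095 - ·)

lemma allHexadMasks_lt : ∀ m ∈ allHexadMasks, m < 4096 := by decide +kernel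

lemma isHexad_iff (S : Finset (Fin 12)) :
    IsHexad S = true ↔ ∃ m ∈ allHexadMasks, maskSet m = S := by
  have hcompl : ∀ m ∈ hexadMasks, m ≤ 4095 := by decide +kernel
  obtain ⟨n, hn, rfl⟩ := exists_maskSet S
  have key : (∃ m ∈ allHexadMasks, maskSet m = maskSet n) ↔ n ∈ allHexadMasks := by
    refine ⟨?_, fun h => ⟨n, h, rfl⟩⟩
    rintro ⟨m, hm, he⟩
    rwa [← setMask_maskSet hn, ← he, setMask_maskSet (allHexadMasks_lt m hm)]
  rw [key, IsHexad, setMask_maskSet hn, allHexadMasks, List.mem_append, List.mem_map,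
    Bool.or_eq_true, List.contains_iff_mem, List.contains_iff_mem]
  refine or_congr Iff.rfl ⟨fun h => ⟨_, h, by omega⟩, ?_⟩
  rintro ⟨m, hm, rfl⟩
  rwa [Nat.sub_sub_self (hcompl m hm)]

/-- The number of hexads that contain the given points is at least four. For four points this says
that they form a harmonic quadruple. -/
def IsHarmonic (a b c d : Fin 12) : Bool :=
  decide (4 ≤ allHexadMasks.countP fun m =>
    m.testBit a && m.testBit b && m.testBit c && m.testBit d)

/-- The count over bit masks suits computation; the count over sets is visibly compatible with
permutations. -/
lemma isHarmonic_iff (a b c d : Fin 12) : IsHarmonic a b c d = true ↔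
    4 ≤ (Finset.univ.filter fun S : Finset (Fin 12) => IsHexad S ∧ {a, b, c, d} ⊆ S).card := by
  have hnd : allHexadMasks.Nodup := by decide +kernel
  have h : (Finset.univ.filter fun S : Finset (Fin 12) => IsHexad S ∧ {a, b, c, d} ⊆ S) =
      ((allHexadMasks.filter fun m => m.testBit a && m.testBit b && m.testBit c &&
        m.testBit d).toFinset).image maskSet := by
    ext S
    simp only [Finset.mem_filter, Finset.mem_univ, true_and, isHexad_iff, Finset.mem_image,
      List.mem_toFinset, List.mem_filter]
    constructor
    · rintro ⟨⟨m, hm, rfl⟩, hs⟩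
      refine ⟨m, ⟨hm, ?_⟩, rfl⟩
      simpa [Finset.insert_subset_iff, maskSet, and_assoc] using hs
    · rintro ⟨m, ⟨hm, ht⟩, rfl⟩
      refine ⟨⟨m, hm, rfl⟩, ?_⟩
      simpa [Finset.insert_subset_iff, maskSet, and_assoc] using ht
  rw [h, Finset.card_image_of_injOn, List.toFinset_card_of_nodup (hnd.filter _),
    ← List.countP_eq_length_filter, IsHarmonic, decide_eq_true_iff]
  intro m hm n hn he
  simp only [Finset.mem_coe, List.mem_toFinset, List.mem_filter] at hm hn
  have he : maskSet m = maskSet n := he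
  rw [← setMask_maskSet (allHexadMasks_lt m hm.1), he, setMask_maskSet (allHexadMasks_lt n hn.1)]

/-- A permutation that maps hexads to hexads. -/
def PreservesHexads (π : Equiv.Perm (Fin 12)) : Prop :=
  ∀ S, IsHexad S = true → IsHexad (S.map π.toEmbedding) = true

lemma PreservesHexads.mul {π ρ : Equiv.Perm (Fin 12)} (hπ : PreservesHexads π)
    (hρ : PreservesHexads ρ) : PreservesHexads (π * ρ) := by
  intro S hS
  have := hπ _ (hρ S hS)
  rwa [Finset.map_map] at this

lemma PreservesHexads.pow {π : Equiv.Perm (Fin 12)} (hπ : PreservesHexads π) (n : ℕ) :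
    PreservesHexads (π ^ n) := by
  induction n with
  | zero =>
    intro S hS
    have : S.map (π ^ 0).toEmbedding = S := by
      rw [pow_zero]; exact Finset.map_refl
    rwa [this]
  | succ n ih => rw [pow_succ]; exact ih.mul hπ

/-- Taking images under `π` injects the hexads through the four points into those through their
images. -/
lemma PreservesHexads.isHarmonic {π : Equiv.Perm (Fin 12)} (hπ : PreservesHexads π)
    {a b c d : Fin 12} (h : IsHarmonic a b c d = true) :
    IsHarmonic (π a) (π b) (π c) (π d) = true := by
  rw [isHarmonic_iff] at h ⊢
  refine h.trans (Finset.card_le_card_of_injOn (fun S => S.map π.toEmbedding) ?_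
    (fun _ _ _ _ h => Finset.map_injective _ h))
  intro S hS
  simp only [Finset.coe_filter, Finset.mem_univ, true_and, Set.mem_ofPred_eq] at hS ⊢
  refine ⟨hπ S hS.1, ?_⟩
  simpa using (Finset.map_subset_map (f := π.toEmbedding)).mpr hS.2

/-- Whether `x ↦ y` is a possible extension of a partial permutation, given by its graph, that
preserves harmonic quadruples. Only the last five points of the graph are used. -/
def isConsistent (l : List (Fin 12 × Fin 12)) (x y : Fin 12) : Bool :=
  (l.all fun p => p.2 != y) && ((l.take 5).sublistsLen 3).all fun t =>
    match t with
    | [u, v, w] => !(IsHarmonic u.1 v.1 w.1 x) || IsHarmonic u.2 v.2 w.2 y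
    | _ => true

/-- Whether all extensions of a partial permutation that preserve harmonic quadruples are the
identity. -/
def isRigid : List (Fin 12) → List (Fin 12 × Fin 12) → Bool
  | [], l => l.all fun p => p.1 == p.2
  | x :: s, l => [0, 1, 2, 3, 4, 5, 6, 7, 8, 9, 10, 11].all fun y =>
      !(isConsistent l x y) || isRigid s ((x, y) :: l)

lemma isConsistent_of_preserves {π : Equiv.Perm (Fin 12)} (hπ : PreservesHexads π)
    {l : List (Fin 12 × Fin 12)} (hl : ∀ p ∈ l, π p.1 = p.2) {x : Fin 12}
    (hx : ∀ p ∈ l, p.1 ≠ x) : isConsistent l x (π x) = true := by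
  rw [isConsistent, Bool.and_eq_true, List.all_eq_true, List.all_eq_true]
  constructor
  · intro p hp
    rw [bne_iff_ne, ← hl p hp]
    exact fun h => hx p hp (π.injective h)
  · intro t ht
    have hsub := ((List.mem_sublistsLen.mp ht).1.trans (List.take_sublist _ _)).subset
    match t, hsub with
    | [], _ => rfl
    | [_], _ => rfl
    | [_, _], _ => rfl
    | [u, v, w], hsub =>
      have hu := hl u (hsub (by simp))
      have hv := hl v (hsub (by simp))
      have hw := hl w (hsub (by simp))
      simp only [Bool.or_eq_true, Bool.not_eq_true']
      rw [← hu, ← hv, ← hw]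
      by_cases h : IsHarmonic u.1 v.1 w.1 x = true
      · exact Or.inr (hπ.isHarmonic h)
      · exact Or.inl (by simpa using h)
    | _ :: _ :: _ :: _ :: _, _ => rfl

/-- The search tree tries all images of the next point. The values of `π` itself pass every
consistency test, so they trace a branch down to a leaf, where rigidity says that the graph is the
identity. -/
lemma eq_self_of_isRigid {π : Equiv.Perm (Fin 12)} (hπ : PreservesHexads π)
    (s : List (Fin 12)) : ∀ l : List (Fin 12 × Fin 12), (s ++ l.map Prod.fst).Nodup →
      isRigid s l = true → (∀ p ∈ l, π p.1 = p.2) → ∀ x ∈ s ++ l.map Prod.fst, π x = x := by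
  induction s with
  | nil =>
    intro l _ h hl x hx
    rw [isRigid, List.all_eq_true] at h
    obtain ⟨p, hp, rfl⟩ := List.mem_map.mp hx
    rw [hl p hp]
    exact (beq_iff_eq.mp (h p hp)).symm
  | cons x s ih =>
    intro l hnd h hl
    rw [isRigid, List.all_eq_true] at h
    have hmem : ∀ y : Fin 12, y ∈ [0, 1, 2, 3, 4, 5, 6, 7, 8, 9, 10, 11] := by decide
    have h1 := h (π x) (hmem _)
    rw [List.cons_append, List.nodup_cons, List.mem_append, not_or] at hnd
    rw [isConsistent_of_preserves hπ hl (fun p hp he =>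
      hnd.1.2 (List.mem_map.mpr ⟨p, hp, he⟩)), Bool.not_true, Bool.false_or] at h1
    have h2 := ih ((x, π x) :: l) ?_ h1 ?_
    · intro z hz
      refine h2 z ?_
      simp only [List.mem_append, List.mem_cons, List.map_cons] at hz ⊢
      tauto
    · rw [List.map_cons, List.nodup_middle, List.nodup_cons, List.mem_append, not_or]
      exact hnd
    · intro p hp
      rcases List.mem_cons.mp hp with rfl | hp
      · rfl
      · exact hl p hp

/-- The harmonic relations propagate from ∞, 0 and 1 to the nine other points, as the exhaustive
search confirms. -/
lemma PreservesHexads.eq_one {π : Equiv.Perm (Fin 12)} (hπ : PreservesHexads π)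
    (h11 : π 11 = 11) (h0 : π 0 = 0) (h1 : π 1 = 1) : π = 1 := by
  have hr : isRigid [2, 3, 4, 5, 6, 7, 8, 9, 10] [(1, 1), (0, 0), (11, 11)] = true := by
    decide +kernel
  have hmem : ∀ x : Fin 12, x ∈ [2, 3, 4, 5, 6, 7, 8, 9, 10] ++
      ([(1, 1), (0, 0), (11, 11)] : List (Fin 12 × Fin 12)).map Prod.fst := by decide
  refine Equiv.ext fun x => eq_self_of_isRigid hπ _ _ (by decide) hr ?_ x (hmem x)
  simp [h11, h0, h1]

/-- `x ↦ x + 1`. -/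
def translation : Equiv.Perm (Fin 12) where
  toFun := ![1, 2, 3, 4, 5, 6, 7, 8, 9, 10, 0, 11]
  invFun := ![10, 0, 1, 2, 3, 4, 5, 6, 7, 8, 9, 11]
  left_inv := by decide
  right_inv := by decide

/-- `x ↦ 2 x`. -/
def doubling : Equiv.Perm (Fin 12) where
  toFun := ![0, 2, 4, 6, 8, 10, 1, 3, 5, 7, 9, 11]
  invFun := ![0, 6, 1, 7, 2, 8, 3, 9, 4, 10, 5, 11]
  left_inv := by decide
  right_inv := by decide

/-- `x ↦ -1 / x`. -/
def inversion : Equiv.Perm (Fin 12) where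
  toFun := ![11, 10, 5, 7, 8, 2, 9, 3, 4, 6, 1, 0]
  invFun := ![11, 10, 5, 7, 8, 2, 9, 3, 4, 6, 1, 0]
  left_inv := by decide
  right_inv := by decide

lemma preservesHexads_of_masks {π : Equiv.Perm (Fin 12)}
    (h : ∀ m ∈ allHexadMasks, IsHexad ((maskSet m).map π.toEmbedding) = true) :
    PreservesHexads π := by
  intro S hS
  obtain ⟨m, hm, rfl⟩ := (isHexad_iff S).mp hS
  exact h m hm

lemma preservesHexads_translation : PreservesHexads translation :=
  preservesHexads_of_masks (by decide +kernel)

lemma preservesHexads_doubling : PreservesHexads doubling :=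
  preservesHexads_of_masks (by decide +kernel)

lemma preservesHexads_inversion : PreservesHexads inversion :=
  preservesHexads_of_masks (by decide +kernel)

/-- The hexads determine the projective linear group. -/
lemma PreservesHexads.mem_of_mem {π : Equiv.Perm (Fin 12)} (hπ : PreservesHexads π)
    {G : Subgroup (Equiv.Perm (Fin 12))} (ht : translation ∈ G) (hd : doubling ∈ G)
    (hi : inversion ∈ G) : π ∈ G := by
  -- The three generators carry the images of ∞, 0, 1 back to ∞, 0, 1 in turn. A translation and
  -- possibly the inversion restore ∞, a further translation restores 0, and a power of doubling
  -- restores 1 because 2 is a primitive root modulo 11.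
  have h1 : ∀ x : Fin 12, ∃ e < 2, ∃ k < 11, (inversion ^ e * translation ^ k) x = 11 := by
    decide +kernel
  have h2 : ∀ x : Fin 12, x ≠ 11 → ∃ k < 11, (translation ^ k) x = 0 := by decide +kernel
  have h3 : ∀ x : Fin 12, x ≠ 11 → x ≠ 0 → ∃ k < 11, (doubling ^ k) x = 1 := by decide +kernel
  have ht11 : ∀ k < 11, (translation ^ k) 11 = 11 := by decide +kernel
  have hd11 : ∀ k < 11, (doubling ^ k) 11 = 11 := by decide +kernel
  have hd0 : ∀ k < 11, (doubling ^ k) 0 = 0 := by decide +kernel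
  obtain ⟨e, -, k, -, h11⟩ := h1 (π 11)
  set ρ := inversion ^ e * translation ^ k with hρ
  have hρG : ρ ∈ G := mul_mem (pow_mem hi e) (pow_mem ht k)
  have hρH : PreservesHexads ρ :=
    (preservesHexads_inversion.pow e).mul (preservesHexads_translation.pow k)
  have hne0 : ρ (π 0) ≠ 11 := by
    rw [← h11]
    exact fun h => absurd (π.injective (ρ.injective h)) (by decide)
  obtain ⟨j, hj, hj0⟩ := h2 _ hne0
  have hne1 : (translation ^ j) (ρ (π 1)) ≠ 11 := by
    rw [← ht11 j hj, ← h11]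
    exact fun h => absurd (π.injective (ρ.injective ((translation ^ j).injective h))) (by decide)
  have hne2 : (translation ^ j) (ρ (π 1)) ≠ 0 := by
    rw [← hj0]
    exact fun h => absurd (π.injective (ρ.injective ((translation ^ j).injective h))) (by decide)
  obtain ⟨i, hi', hi1⟩ := h3 _ hne1 hne2
  have hw : doubling ^ i * translation ^ j * ρ ∈ G :=
    mul_mem (mul_mem (pow_mem hd i) (pow_mem ht j)) hρG
  have hone := PreservesHexads.eq_one
    ((((preservesHexads_doubling.pow i).mul (preservesHexads_translation.pow j)).mul hρH).mul hπ)
    (by simp only [Equiv.Perm.mul_apply] at h11 ⊢; rw [h11, ht11 j hj, hd11 i hi'])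
    (by simp only [Equiv.Perm.mul_apply] at hj0 ⊢; rw [hj0, hd0 i hi'])
    (by simp only [Equiv.Perm.mul_apply] at hi1 ⊢; rw [hi1])
  rw [eq_inv_of_mul_eq_one_right hone]
  exact inv_mem hw

/-! ### The projective linear group as a permutation group -/

/-- The labels `0, …, 10, 11` of the points of the projective line. -/
noncomputable def pointLabel : OnePoint (ZMod 11) ≃ Fin 12 :=
  (finSuccEquivLast (n := 11)).symm

/-- The label of a point of the affine line. -/
def affineLabel (k : ZMod 11) : Fin 12 := Fin.castSucc (n := 11) k

lemma pointLabel_coe (k : ZMod 11) : pointLabel (k : OnePoint (ZMod 11)) = affineLabel k :=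
  finSuccEquivLast_symm_some (n := 11) k

instance : Fact (Nat.Prime 11) := ⟨by norm_num⟩

/-- The action of the general linear group on the labelled projective line. -/
noncomputable def moebiusPerm :
    Matrix.GeneralLinearGroup (Fin 2) (ZMod 11) →* Equiv.Perm (Fin 12) :=
  (pointLabel.permCongrHom : Equiv.Perm (OnePoint (ZMod 11)) →* Equiv.Perm (Fin 12)).comp
    (MulAction.toPermHom _ _)

lemma moebiusPerm_apply (g : Matrix.GeneralLinearGroup (Fin 2) (ZMod 11)) (x : OnePoint (ZMod 11)) :
    moebiusPerm g (pointLabel x) = pointLabel (g • x) := by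
  simp [moebiusPerm]

/-- The action of the projective linear group on the labelled projective line. -/
noncomputable def projectivePerm :
    Matrix.ProjGenLinGroup (Fin 2) (ZMod 11) →* Equiv.Perm (Fin 12) :=
  Matrix.ProjGenLinGroup.lift moebiusPerm <| by
    ext1 u
    refine Equiv.ext fun i => ?_
    obtain ⟨x, rfl⟩ := pointLabel.surjective i
    rw [MonoidHom.comp_apply, moebiusPerm_apply, MonoidHom.one_apply, Equiv.Perm.one_apply]
    congr 1
    cases x with
    | infty => simp [OnePoint.smul_infty_eq_ite]
    | coe k => simp [OnePoint.smul_some_eq_ite]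

lemma mem_range_projectivePerm (g : Matrix (Fin 2) (Fin 2) (ZMod 11)) (hg : g.det ≠ 0)
    (π : Equiv.Perm (Fin 12)) (h : ∀ x : OnePoint (ZMod 11),
      pointLabel (Matrix.GeneralLinearGroup.mkOfDetNeZero g hg • x) = π (pointLabel x)) :
    π ∈ projectivePerm.range := by
  refine ⟨.mk (Matrix.GeneralLinearGroup.mkOfDetNeZero g hg), Equiv.ext fun i => ?_⟩
  obtain ⟨x, rfl⟩ := pointLabel.surjective i
  rw [← h, ← moebiusPerm_apply]
  rfl

lemma translation_mem_range : translation ∈ projectivePerm.range := by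
  refine mem_range_projectivePerm !![1, 1; 0, 1] (by decide) _ fun x => ?_
  cases x with
  | infty =>
    rw [OnePoint.smul_infty_eq_ite]
    simp [Matrix.GeneralLinearGroup.mkOfDetNeZero]
    rfl
  | coe k =>
    rw [OnePoint.smul_some_eq_ite]
    have h : ∀ k : ZMod 11, affineLabel (k + 1) = translation (affineLabel k) := by decide
    simpa [Matrix.GeneralLinearGroup.mkOfDetNeZero, pointLabel_coe] using h k

lemma doubling_mem_range : doubling ∈ projectivePerm.range := by
  refine mem_range_projectivePerm !![2, 0; 0, 1] (by decide) _ fun x => ?_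
  cases x with
  | infty =>
    rw [OnePoint.smul_infty_eq_ite]
    simp [Matrix.GeneralLinearGroup.mkOfDetNeZero]
    rfl
  | coe k =>
    rw [OnePoint.smul_some_eq_ite]
    have h : ∀ k : ZMod 11, affineLabel (2 * k) = doubling (affineLabel k) := by decide
    simpa [Matrix.GeneralLinearGroup.mkOfDetNeZero, pointLabel_coe] using h k

lemma inversion_mem_range : inversion ∈ projectivePerm.range := by
  refine mem_range_projectivePerm !![0, -1; 1, 0] (by decide) _ fun x => ?_
  cases x with
  | infty =>
    rw [OnePoint.smul_infty_eq_ite]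
    simp [Matrix.GeneralLinearGroup.mkOfDetNeZero]
    rfl
  | coe k =>
    rw [OnePoint.smul_some_eq_ite]
    simp [Matrix.GeneralLinearGroup.mkOfDetNeZero]
    have h : ∀ k : ZMod 11, k ≠ 0 → ∃ c : ZMod 11, c * k = -1 ∧
        affineLabel c = inversion (affineLabel k) := by
      decide
    split_ifs with hk
    · rw [hk]; rfl
    · obtain ⟨c, hc, hi⟩ := h k hk
      rw [← (eq_div_iff hk).mpr hc]
      rw [pointLabel_coe, pointLabel_coe]
      exact hi

instance : Finite (Matrix.ProjGenLinGroup (Fin 2) (ZMod 11)) :=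
  Finite.of_surjective _ Matrix.ProjGenLinGroup.mk_surjective

/-- The general linear group has order (121 - 1)(121 - 11) = 13200 and its centre consists of the 10
nonzero scalars. Only the upper bound is needed. -/
lemma card_projGenLinGroup_le : Nat.card (Matrix.ProjGenLinGroup (Fin 2) (ZMod 11)) ≤ 1320 := by
  have h1 : Nat.card (Matrix.GeneralLinearGroup (Fin 2) (ZMod 11)) = 13200 := by
    rw [Matrix.card_GL_field, Fin.prod_univ_two, ZMod.card]; rfl
  have h2 := Subgroup.card_eq_card_quotient_mul_card_subgroup
    (Subgroup.center (Matrix.GeneralLinearGroup (Fin 2) (ZMod 11)))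
  have h3 : Nat.card (Subgroup.center (Matrix.GeneralLinearGroup (Fin 2) (ZMod 11))) = 10 := by
    rw [Matrix.GeneralLinearGroup.center_eq_range_scalar]
    have hinj : Function.Injective
        (Matrix.GeneralLinearGroup.scalar (Fin 2) :
          (ZMod 11)ˣ →* Matrix.GeneralLinearGroup (Fin 2) (ZMod 11)) := by
      intro u v h
      have h1 := congrArg (fun g : Matrix.GeneralLinearGroup (Fin 2) (ZMod 11) => g 0 0) h
      exact Units.ext (by simpa using h1)
    rw [← Nat.card_congr (MonoidHom.ofInjective hinj).toEquiv, Nat.card_eq_fintype_card,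
      ZMod.card_units]
  rw [h1, h3] at h2
  have h4 : Nat.card (Matrix.ProjGenLinGroup (Fin 2) (ZMod 11)) * 10 = 13200 := h2.symm
  omega

/-! ### Identification of the Galois group -/

lemma eval_eq_zero_of_aeval_g0 {K : Type*} [Field K] [Algebra ℚ K] {x : K} (h : aeval x g₀ = 0) :
    ListPoly.eval x g0Coeffs = 0 := by
  rwa [aeval_def, ← eval_map, map_g0, ← eval₂_id, eval₂_map_g0] at h

/-- The action of the automorphisms of a splitting field on the numbered roots. -/
lemma exists_permHom {L : Type*} [Field L] [NumberField L] [hsf : IsSplittingField ℚ L g₀]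
    {r : Fin 12 → 𝓞 L} (hinj : Function.Injective r)
    (hr : ∀ i, ListPoly.eval (r i) g0Coeffs = 0) :
    ∃ ψ : (L ≃ₐ[ℚ] L) →* Equiv.Perm (Fin 12), Function.Injective ψ ∧
      ∀ σ i, σ • r i = r (ψ σ i) := by
  choose π hπ using exists_perm hinj hr
  have hmul : ∀ σ τ, π (σ * τ) = π σ * π τ := fun σ τ => Equiv.ext fun i => hinj (by
    rw [← hπ, mul_smul, hπ τ, hπ σ]; rfl)
  refine ⟨MonoidHom.mk' π hmul, ?_, hπ⟩
  rw [injective_iff_map_eq_one]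
  intro σ hσ
  -- An automorphism that fixes all the roots is trivial, because they generate `L`.
  have hle : Algebra.adjoin ℚ (g₀.rootSet L) ≤
      AlgHom.equalizer (σ : L →ₐ[ℚ] L) (AlgHom.id ℚ L) := by
    rw [Algebra.adjoin_le_iff]
    intro x hx
    have hx0 := eval_eq_zero_of_aeval_g0 (mem_rootSet.mp hx).2
    have hint : IsIntegral ℤ x := ⟨g0Int, g0Int_monic, by
      rw [← aeval_def, g0Int, ← ListPoly.eval_eq_aeval]; exact hx0⟩
    obtain ⟨i, hi⟩ := exists_eq_of_eval_g0 hinj hr (x := ⟨x, hint⟩) (RingOfIntegers.ext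
      (((ListPoly.map_eval (algebraMap (𝓞 L) L) ⟨x, hint⟩ g0Coeffs).trans hx0).trans
        (map_zero (algebraMap (𝓞 L) L)).symm))
    have h1 := hπ σ i
    have h2 : π σ = 1 := hσ
    rw [h2, Equiv.Perm.one_apply, ← hi] at h1
    exact congrArg (algebraMap (𝓞 L) L) h1
  rw [hsf.adjoin_rootSet] at hle
  exact AlgEquiv.ext fun x => hle (Algebra.mem_top (x := x))

/-- Automorphisms fix 0, so they permute the zeros of the resolvent among the six-sets. -/
lemma preservesHexads_of_smul {L : Type*} [Field L] [NumberField L] {r : Fin 12 → 𝓞 L}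
    (hhex : ∀ S : Finset (Fin 12), S.card = 6 → (hexadValue r S = 0 ↔ IsHexad S = true))
    {σ : L ≃ₐ[ℚ] L} {π : Equiv.Perm (Fin 12)} (h : ∀ i, σ • r i = r (π i)) :
    PreservesHexads π := by
  have hc : ∀ m ∈ allHexadMasks, maskSum m [1, 1, 1, 1, 1, 1, 1, 1, 1, 1, 1, 1] = 6 := by
    decide +kernel
  intro S hS
  have hcard : S.card = 6 := by
    obtain ⟨m, hm, rfl⟩ := (isHexad_iff S).mp hS
    have := card_maskSet m
    rw [hc m hm] at this
    exact_mod_cast this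
  rw [← hhex _ (by rw [Finset.card_map, hcard]), ← smul_hexadValue h, (hhex S hcard).mpr hS,
    smul_zero]

/-- The Galois group of `g₀` is the projective linear group acting on the projective line. -/
theorem nonempty_galois_mulEquiv :
    Nonempty (g₀.Gal ≃* Matrix.ProjGenLinGroup (Fin 2) (ZMod 11)) := by
  have hfin : FiniteDimensional ℚ g₀.SplittingField := inferInstance
  have : NumberField g₀.SplittingField :=
    { to_charZero := inferInstance, to_finiteDimensional := hfin }
  have hsf : IsSplittingField ℚ g₀.SplittingField g₀ := IsSplittingField.splittingField g₀
  have : IsGalois ℚ g₀.SplittingField :=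
    IsGalois.of_separable_splitting_field (p := g₀) g0_irreducible.separable
  obtain ⟨r, hinj, hr, hhex⟩ := exists_hexad_numbering g₀.SplittingField
  obtain ⟨ψ, hψ, hψr⟩ := exists_permHom hinj hr
  have hle : ψ.range ≤ projectivePerm.range := by
    rintro _ ⟨σ, rfl⟩
    exact (preservesHexads_of_smul hhex (hψr σ)).mem_of_mem translation_mem_range
      doubling_mem_range inversion_mem_range
  have hcard1 : 1320 ≤ Nat.card ψ.range := by
    rw [← Nat.card_congr (MonoidHom.ofInjective hψ).toEquiv]
    exact Nat.le_of_dvd Nat.card_pos (dvd_card_galois hinj hr)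
  have hcard2 : Nat.card projectivePerm.range ≤
      Nat.card (Matrix.ProjGenLinGroup (Fin 2) (ZMod 11)) :=
    Nat.card_le_card_of_surjective _ projectivePerm.rangeRestrict_surjective
  -- The order of $G$ is at least 1320 and that of $\mathrm{PGL}_2(11)$ at most 1320, so the
  -- inclusion of images is an equality. The same count makes `projectivePerm` injective.
  have heq : ψ.range = projectivePerm.range := by
    refine Subgroup.eq_of_le_of_card_ge hle ?_
    exact hcard2.trans (card_projGenLinGroup_le.trans hcard1)
  have hφ : Function.Injective projectivePerm.rangeRestrict := by
    have : Nat.card (Matrix.ProjGenLinGroup (Fin 2) (ZMod 11)) = Nat.card projectivePerm.range :=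
      le_antisymm (card_projGenLinGroup_le.trans (hcard1.trans_eq (by rw [heq]))) hcard2
    exact ((Nat.bijective_iff_surjective_and_card _).mpr
      ⟨projectivePerm.rangeRestrict_surjective, this⟩).1
  exact ⟨(MonoidHom.ofInjective hψ).trans ((MulEquiv.subgroupCongr heq).trans
    (MulEquiv.ofBijective _ ⟨hφ, projectivePerm.rangeRestrict_surjective⟩).symm)⟩

/-! ### Dedekind's criterion -/

lemma exists_eq_add_of_map_eq {p : ℕ} {f g : ℤ[X]}
    (h : f.map (Int.castRingHom (ZMod p)) = g.map (Int.castRingHom (ZMod p))) :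
    ∃ c : ℤ[X], f = g + C (p : ℤ) * c := by
  have hd : C (p : ℤ) ∣ f - g := by
    rw [C_dvd_iff_dvd_coeff]
    intro i
    have := congrArg (fun q => coeff q i) h
    simp only [coeff_map, eq_intCast] at this
    rw [coeff_sub]
    exact (ZMod.intCast_eq_intCast_iff_dvd_sub _ _ _).mp this.symm
  obtain ⟨c, hc⟩ := hd
  exact ⟨c, by rw [← hc]; ring⟩

section
variable {K : Type*} [Field K] [NumberField K] {θ : 𝓞 K} {h : ℤ[X]}

lemma dvd_of_aeval_eq_zero (hm : h.Monic) (hirr : Irreducible (h.map (Int.castRingHom ℚ)))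
    (hθ : aeval θ h = 0) {f : ℤ[X]} (hf : aeval θ f = 0) : h ∣ f := by
  have hint : IsIntegral ℤ θ := ⟨h, hm, hθ⟩
  rw [← algebraMap_int_eq, ← hm.irreducible_iff_irreducible_map_fraction_map] at hirr
  exact ((minpoly.irreducible hint).dvd_symm hirr
    (minpoly.isIntegrallyClosed_dvd hint hθ)).trans (minpoly.isIntegrallyClosed_dvd hint hf)

/-- The primes over `p` that contain the value of an irreducible factor modulo `p` of the minimal
polynomial. -/
lemma exists_heightOneSpectrum (hm : h.Monic) (hirr : Irreducible (h.map (Int.castRingHom ℚ)))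
    (hθ : aeval θ h = 0) {p : ℕ} [Fact p.Prime] {π : (ZMod p)[X]} (hπ : Irreducible π)
    (hπh : π ∣ h.map (Int.castRingHom (ZMod p))) :
    ∃ v : HeightOneSpectrum (𝓞 K), (∀ f : ℤ[X], aeval θ f ∈ v.asIdeal ↔
      π ∣ f.map (Int.castRingHom (ZMod p))) := by
  let _ : Algebra ℤ[X] (𝓞 K) := (aeval θ : ℤ[X] →ₐ[ℤ] 𝓞 K).toRingHom.toAlgebra
  have hmap : ∀ f : ℤ[X], algebraMap ℤ[X] (𝓞 K) f = aeval θ f := fun _ => rfl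
  have : IsScalarTower ℤ ℤ[X] (𝓞 K) := IsScalarTower.of_algebraMap_eq fun n => by
    rw [hmap, eq_intCast, eq_intCast, map_intCast]
  have : Algebra.IsIntegral ℤ[X] (𝓞 K) := ⟨fun x =>
    (Algebra.IsIntegral.isIntegral (R := ℤ) x).tower_top⟩
  have hP0 : (Ideal.span {π}).IsPrime := (Ideal.span_singleton_prime hπ.ne_zero).mpr hπ.prime
  -- The prime of `ℤ[X]` cut out by `p` and `π` contains the kernel of evaluation at `θ`, which is
  -- generated by `h`; integrality then provides a prime of the integers of `K` above it.
  obtain ⟨P, -, hP, hcomap⟩ := Ideal.exists_ideal_over_prime_of_isIntegral (S := 𝓞 K)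
    ((Ideal.span {π}).comap (mapRingHom (Int.castRingHom (ZMod p)))) ⊥ (by
      intro f hf
      have hf : aeval θ f = 0 := hf
      rw [Ideal.mem_comap, Ideal.mem_span_singleton, coe_mapRingHom]
      exact hπh.trans (Polynomial.map_dvd _ (dvd_of_aeval_eq_zero hm hirr hθ hf)))
  have hiff : ∀ f : ℤ[X], aeval θ f ∈ P ↔ π ∣ f.map (Int.castRingHom (ZMod p)) := fun f => by
    rw [← hmap, ← Ideal.mem_comap, hcomap, Ideal.mem_comap, Ideal.mem_span_singleton,
      coe_mapRingHom]
  refine ⟨⟨P, hP, fun hbot => ?_⟩, hiff⟩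
  have hp : aeval θ (C (p : ℤ)) ∈ P := by rw [hiff]; simp
  rw [hbot, Ideal.mem_bot, aeval_C] at hp
  have hp0 : (p : 𝓞 K) ≠ 0 := Nat.cast_ne_zero.mpr (Fact.out : p.Prime).ne_zero
  exact hp0 (by simpa using hp)

/-- Take a prime above `p` that contains the value of `π`. For `e ≥ 2`, the relation `φ ^ e * ψ = -p
* F` at `θ` has `ψ` and `F` prime to it, so the order of `p` there is `e` times that of `φ`. If `π`
divided `y` modulo `p` only `k < e` times, the value of `y` would have smaller order than `p`. For
`e = 1` it would be a unit there, and `F` plays no role. -/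
lemma irreducible_pow_dvd_of_dvd_aeval (hm : h.Monic)
    (hirr : Irreducible (h.map (Int.castRingHom ℚ)))
    (hθ : aeval θ h = 0) {p : ℕ} [Fact p.Prime] {φ ψ F : ℤ[X]} {e : ℕ}
    (hfac : h = φ ^ e * ψ + C (p : ℤ) * F)
    (hsq : Squarefree (φ.map (Int.castRingHom (ZMod p))))
    (hψ : IsCoprime (φ.map (Int.castRingHom (ZMod p))) (ψ.map (Int.castRingHom (ZMod p))))
    (hF : 2 ≤ e → IsCoprime (φ.map (Int.castRingHom (ZMod p))) (F.map (Int.castRingHom (ZMod p))))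
    {y : ℤ[X]} (hy : (p : 𝓞 K) ∣ aeval θ y) {π : (ZMod p)[X]} (hπ : Irreducible π)
    (hπφ : π ∣ φ.map (Int.castRingHom (ZMod p))) :
    π ^ e ∣ y.map (Int.castRingHom (ZMod p)) := by
  rcases Nat.eq_zero_or_pos e with rfl | he
  · simp
  have hπh : π ∣ h.map (Int.castRingHom (ZMod p)) := by
    rw [hfac]
    have hC : (C (p : ℤ)).map (Int.castRingHom (ZMod p)) = 0 := by simp
    rw [Polynomial.map_add, Polynomial.map_mul, Polynomial.map_mul, Polynomial.map_pow, hC,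
      zero_mul, add_zero]
    exact (hπφ.trans (dvd_pow_self _ he.ne')).mul_right _
  obtain ⟨v, hv⟩ := exists_heightOneSpectrum hm hirr hθ hπ hπh
  have hsurj := Polynomial.map_surjective _ (ZMod.ringHom_surjective (Int.castRingHom (ZMod p)))
  set w : ℤ[X] → _ := fun f => v.intValuation (aeval θ f) with hw
  have hw1 : ∀ f : ℤ[X], w f ≤ 1 := fun f => v.intValuation_le_one _
  have hwmul : ∀ f g, w (f * g) = w f * w g := fun f g => by simp only [hw, map_mul]
  have hwpow : ∀ f n, w (f ^ n) = w f ^ n := fun f n => by simp only [hw, map_pow]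
  have hwadd : ∀ f g, w (f + g) ≤ max (w f) (w g) := fun f g => by
    simp only [hw, map_add]; exact Valuation.map_add _ _ _
  have hlt : ∀ f, w f < 1 ↔ π ∣ f.map (Int.castRingHom (ZMod p)) := fun f => by
    rw [← hv]; exact v.intValuation_lt_one_iff_mem _
  have hone : ∀ f : ℤ[X], ¬ π ∣ f.map (Int.castRingHom (ZMod p)) → w f = 1 := fun f hf =>
    le_antisymm (hw1 f) (not_lt.mp fun h => hf ((hlt f).mp h))
  have hcop : ∀ f : ℤ[X], IsCoprime (φ.map (Int.castRingHom (ZMod p)))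
      (f.map (Int.castRingHom (ZMod p))) → w f = 1 := fun f hf => hone f fun h =>
    hπ.not_isUnit (hf.isUnit_of_dvd' hπφ h)
  set q := w (C (p : ℤ)) with hq
  have hqval : q = v.intValuation (p : 𝓞 K) := by simp [hq, hw]
  have hq0 : q ≠ 0 := by
    rw [hqval]
    exact v.intValuation_ne_zero _ (Nat.cast_ne_zero.mpr (Fact.out : p.Prime).ne_zero)
  have hq1 : q < 1 := (hlt _).mpr (by simp)
  have hCle : ∀ c : ℤ[X], w (C (p : ℤ) * c) ≤ q := fun c => by
    rw [hwmul]; exact mul_le_of_le_one_right' (hw1 c)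
  have hyq : w y ≤ q := by
    obtain ⟨z, hz⟩ := hy
    simp only [hw, hz, map_mul, hqval]
    exact mul_le_of_le_one_right' (v.intValuation_le_one _)
  -- write `y` modulo `p` as a power of `π` times a polynomial not divisible by `π`
  by_contra hnd
  have hy0 : y.map (Int.castRingHom (ZMod p)) ≠ 0 := fun h => hnd (h ▸ dvd_zero _)
  obtain ⟨k, u, hu, hyu⟩ := WfDvdMonoid.max_power_factor hy0 hπ
  have hke : k < e := by
    by_contra hke
    exact hnd (hyu ▸ (pow_dvd_pow π (not_lt.mp hke)).mul_right u)
  obtain ⟨π', rfl⟩ := hsurj π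
  obtain ⟨u', rfl⟩ := hsurj u
  have hπk : w π' ^ k ≤ q := by
    obtain ⟨c, hc⟩ := exists_eq_add_of_map_eq (p := p) (f := π' ^ k * u') (g := y) (by simp [hyu])
    have h1 : w (π' ^ k * u') = w π' ^ k := by rw [hwmul, hwpow, hone u' hu, mul_one]
    rw [← h1, hc]
    exact (hwadd _ _).trans (max_le hyq (hCle c))
  rcases Nat.lt_or_ge e 2 with he2 | he2
  · obtain rfl : k = 0 := by omega
    rw [pow_zero] at hπk
    exact absurd hq1 (not_lt.mpr hπk)
  have hφe : w φ ^ e = q := by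
    have h0 : aeval θ (φ ^ e * ψ) = aeval θ (-(C (p : ℤ) * F)) := by
      have := hθ
      rw [hfac, map_add] at this
      rw [map_neg]; exact eq_neg_of_add_eq_zero_left this
    have h1 : w (φ ^ e * ψ) = w (C (p : ℤ) * F) := by
      simp only [hw]; rw [h0, map_neg, Valuation.map_neg]
    rwa [hwmul, hwpow, hwmul, hcop ψ hψ, hcop F (hF he2), mul_one, mul_one] at h1
  have hφ0 : w φ ≠ 0 := fun h => hq0 (by rw [← hφe, h, zero_pow (by omega)])
  have hφ1 : w φ < 1 := (hlt φ).mpr hπφ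
  have hanti : ∀ {m n : ℕ}, m < n → w φ ^ n < w φ ^ m := fun {m n} hmn =>
    pow_lt_pow_right_of_lt_one₀ (zero_lt_iff.mpr hφ0) hφ1 hmn
  have hπφw : w π' = w φ := by
    -- By squarefreeness `φ` is `π` times a factor prime to `π`, up to a multiple of `p`. For `e ≥
    -- 2` that multiple has larger order than `φ`, so `π` and `φ` have equal order.
    obtain ⟨t, ht⟩ := hπφ
    have htn : ¬ π'.map (Int.castRingHom (ZMod p)) ∣ t := by
      rintro ⟨s, rfl⟩
      exact hπ.not_isUnit (hsq _ ⟨s, by rw [ht]; ring⟩)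
    obtain ⟨t', rfl⟩ := hsurj t
    obtain ⟨c, hc⟩ := exists_eq_add_of_map_eq (p := p) (f := π' * t') (g := φ) (by simp [ht])
    have h1 : w (π' * t') = w π' := by rw [hwmul, hone t' htn, mul_one]
    have h2 : w (C (p : ℤ) * c) < w φ := (hCle c).trans_lt (by
      rw [← hφe]; simpa using hanti (m := 1) (n := e) he2)
    rw [← h1, hc]
    simp only [hw, map_add] at h2 ⊢
    exact Valuation.map_add_eq_of_lt_left _ h2
  rw [hπφw, ← hφe] at hπk
  exact absurd (hanti hke) (not_lt.mpr hπk)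

/-- Distinct irreducible factors of a squarefree polynomial are coprime, so their powers combine.
Thus the irreducible factors of `φ` modulo `p` never have to be computed. -/
lemma pow_dvd_of_dvd_aeval (hm : h.Monic)
    (hirr : Irreducible (h.map (Int.castRingHom ℚ)))
    (hθ : aeval θ h = 0) {p : ℕ} [Fact p.Prime] {φ ψ F : ℤ[X]} {e : ℕ}
    (hfac : h = φ ^ e * ψ + C (p : ℤ) * F)
    (hsq : Squarefree (φ.map (Int.castRingHom (ZMod p))))
    (hψ : IsCoprime (φ.map (Int.castRingHom (ZMod p))) (ψ.map (Int.castRingHom (ZMod p))))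
    (hF : 2 ≤ e → IsCoprime (φ.map (Int.castRingHom (ZMod p))) (F.map (Int.castRingHom (ZMod p))))
    {y : ℤ[X]} (hy : (p : 𝓞 K) ∣ aeval θ y) :
    φ.map (Int.castRingHom (ZMod p)) ^ e ∣ y.map (Int.castRingHom (ZMod p)) := by
  have key : ∀ f : (ZMod p)[X], f ∣ φ.map (Int.castRingHom (ZMod p)) →
      f ^ e ∣ y.map (Int.castRingHom (ZMod p)) := by
    intro f
    induction f using UniqueFactorizationMonoid.induction_on_prime with
    | h₁ => exact fun h0 => absurd (zero_dvd_iff.mp h0) hsq.ne_zero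
    | h₂ x hx => exact fun _ => (hx.pow e).dvd
    | h₃ a π _ hπ ih =>
      intro hd
      have hna : ¬ π ∣ a := by
        rintro ⟨s, rfl⟩
        exact hπ.not_isUnit (hsq _ ((Dvd.intro s (mul_assoc _ _ _)).trans hd))
      rw [mul_pow]
      exact IsCoprime.mul_dvd ((hπ.irreducible.coprime_iff_not_dvd.mpr hna).pow)
        (irreducible_pow_dvd_of_dvd_aeval hm hirr hθ hfac hsq hψ hF hy hπ.irreducible
          ((dvd_mul_right _ _).trans hd)) (ih ((dvd_mul_left _ _).trans hd))
  exact key _ dvd_rfl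

end

/-! ### Discriminants from certificates -/

/-- The powers of an integral generator have discriminant equal to the square of their index times
the discriminant of the field. -/
lemma exists_index {K : Type*} [Field K] [NumberField K] {n : ℕ}
    (hn : Module.finrank ℚ K = n) (θ : 𝓞 K) :
    ∃ j : ℤ, Algebra.discr ℚ (fun i : Fin n => (θ : K) ^ (i : ℕ)) = j ^ 2 * discr K ∧
      ∀ p : ℕ, p.Prime → (p : ℤ) ∣ j → ∃ v : Fin n → ℤ, (∃ i, ¬ (p : ℤ) ∣ v i) ∧
        (p : 𝓞 K) ∣ ∑ i, v i * θ ^ (i : ℕ) := by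
  have hcard : Fintype.card (Module.Free.ChooseBasisIndex ℤ (𝓞 K)) = n := by
    rw [← Module.finrank_eq_card_chooseBasisIndex, RingOfIntegers.rank, hn]
  let e := Fintype.equivFinOfCardEq hcard
  let b := (RingOfIntegers.basis K).reindex e
  let M : Matrix (Fin n) (Fin n) ℤ := Matrix.of fun k i => b.repr (θ ^ (i : ℕ)) k
  have hsum : ∀ i : Fin n, θ ^ (i : ℕ) = ∑ k, M k i • b k := fun i => (b.sum_repr _).symm
  refine ⟨M.det, ?_, ?_⟩
  · have hb : ∀ k, (b k : K) = integralBasis K (e.symm k) := fun k => by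
      simp [b, integralBasis_apply]
    have h1 : (fun i : Fin n => (θ : K) ^ (i : ℕ)) =
        Matrix.vecMul (fun k => (b k : K)) ((M.map (Int.cast : ℤ → ℚ)).map (algebraMap ℚ K)) := by
      funext i
      have := congrArg (algebraMap (𝓞 K) K) (hsum i)
      rw [map_pow, map_sum] at this
      rw [this, Matrix.vecMul, dotProduct]
      refine Finset.sum_congr rfl fun k _ => ?_
      simp [mul_comm]
    rw [h1, Algebra.discr_of_matrix_vecMul, coe_discr]
    have h2 : (fun k => (b k : K)) = integralBasis K ∘ e.symm := funext hb
    rw [h2, Algebra.discr_reindex]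
    congr 2
    exact (Int.cast_det M).symm
  · intro p hp hpj
    have := Fact.mk hp
    have hdet : (M.map (Int.cast : ℤ → ZMod p)).det = 0 := by
      have h := Int.cast_det (R := ZMod p) M
      rw [(ZMod.intCast_zmod_eq_zero_iff_dvd _ p).mpr hpj] at h
      exact h.symm
    -- A kernel vector modulo `p` of the change of basis matrix is a combination of powers,
    -- nontrivial modulo `p`, that `p` divides.
    obtain ⟨v, hv, hvM⟩ := Matrix.exists_mulVec_eq_zero_iff.mpr hdet
    choose w hw using fun i => ZMod.intCast_surjective (v i)
    obtain ⟨i, hi⟩ := Function.ne_iff.mp hv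
    refine ⟨w, ⟨i, fun hd => hi ?_⟩, ?_⟩
    · rw [← hw]; exact (ZMod.intCast_zmod_eq_zero_iff_dvd _ p).mpr hd
    have hk : ∀ k, (p : ℤ) ∣ ∑ i, w i * M k i := fun k => by
      rw [← ZMod.intCast_zmod_eq_zero_iff_dvd]
      have := congrFun hvM k
      rw [Matrix.mulVec, dotProduct] at this
      push_cast
      simpa [hw, mul_comm] using this
    have hswap : ∑ i, (w i : 𝓞 K) * θ ^ (i : ℕ) = ∑ k, (∑ i, w i * M k i) • b k := by
      simp only [hsum, Finset.mul_sum, Finset.sum_smul]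
      rw [Finset.sum_comm]
      refine Finset.sum_congr rfl fun k _ => Finset.sum_congr rfl fun i _ => ?_
      rw [mul_smul, zsmul_eq_mul, zsmul_eq_mul]
    rw [hswap]
    refine Finset.dvd_sum fun k _ => ?_
    obtain ⟨c, hc⟩ := hk k
    rw [hc, zsmul_eq_mul]
    exact ⟨c * b k, by push_cast; ring⟩

/-- A norm from a triangularization of the matrix of a multiplication map. -/
lemma norm_mul_prod_eq {F K : Type*} [Field F] [Field K] [Algebra F K] {n : ℕ}
    (B : Module.Basis (Fin n) F K) (x : K) (P T : Matrix (Fin n) (Fin n) F)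
    (hP : ∀ i k, i < k → P i k = 0) (hT : ∀ i k, k < i → T i k = 0)
    (h : ∀ i, x * ∑ k, P i k • B k = ∑ k, T i k • B k) :
    Algebra.norm F x * ∏ i, P i i = ∏ i, T i i := by
  have hmul : Algebra.leftMulMatrix B x * P.transpose = T.transpose := by
    ext k i
    have hr : ∀ M : Matrix (Fin n) (Fin n) F, ∀ i, (B.repr (∑ k, M i k • B k) : Fin n → F) = M i :=
      fun M i => B.repr_sum_self _
    have := congrFun (Algebra.leftMulMatrix_mulVec_repr B x (∑ k, P i k • B k)) k
    rw [h, hr, hr] at this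
    exact this
  rw [Algebra.norm_eq_matrix_det B, ← Matrix.det_of_isLowerTriangular P fun i k hik => hP i k hik,
    ← Matrix.det_of_isUpperTriangular (M := T) fun i k hik => hT i k hik, ← Matrix.det_transpose P,
    ← Matrix.det_mul, hmul, Matrix.det_transpose]

namespace ListPoly

lemma eval_eq_sum {R : Type*} [CommRing R] (θ : R) {n : ℕ} {l : List ℤ} (hl : l.length ≤ n) :
    eval θ l = ∑ k : Fin n, (l.getD k 0 : R) * θ ^ (k : ℕ) := by
  rw [Fin.sum_univ_eq_sum_range (fun k => (l.getD k 0 : R) * θ ^ k)]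
  induction n generalizing l with
  | zero => rw [List.length_eq_zero_iff.mp (Nat.le_zero.mp hl)]; simp
  | succ n ih =>
    rw [Finset.sum_range_succ']
    cases l with
    | nil => simp
    | cons c l =>
      rw [eval_cons, ih (by simpa using hl), Finset.mul_sum]
      simp only [List.getD_cons_succ, List.getD_cons_zero, pow_zero, mul_one, pow_succ]
      rw [add_comm]
      congr 1
      exact Finset.sum_congr rfl fun k _ => by ring

lemma eval_append_one {R : Type*} [CommRing R] (θ : R) (c : List ℤ) :
    eval θ (c ++ [1]) = eval θ c + θ ^ c.length := by
  induction c with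
  | nil => simp
  | cons x c ih => simp [ih, pow_succ]; ring

lemma isCoprime_of_bezout {p : ℕ} (a b u v : List ℤ)
    (h : eqMod p (add (mul u a) (mul v b)) [1] = true) :
    IsCoprime ((toPoly a).map (Int.castRingHom (ZMod p)))
      ((toPoly b).map (Int.castRingHom (ZMod p))) := by
  have hp : (((p : ℕ) : ℤ) : (ZMod p)[X]) = 0 := by
    rw [Int.cast_natCast]; exact CharP.cast_eq_zero _ p
  have := eval_eq_of_eqMod (X : (ZMod p)[X]) hp h
  rw [eval_add, eval_mul, eval_mul] at this
  rw [map_toPoly, map_toPoly]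
  exact ⟨eval X u, eval X v, by rw [this]; simp⟩

lemma squarefree_of_bezout {p : ℕ} [Fact p.Prime] (a u v : List ℤ)
    (h : eqMod p (add (mul u a) (mul v (deriv a))) [1] = true) :
    Squarefree ((toPoly a).map (Int.castRingHom (ZMod p))) := by
  refine Separable.squarefree ?_
  rw [Separable, derivative_map, derivative_toPoly]
  exact isCoprime_of_bezout _ _ u v h

/-- Whether the lower triangular matrix `P` makes the matrix of the multiplication by `d` modulo
the monic polynomial `X ^ 12 - rem` upper triangular. -/
def normCert (rem d : List ℤ) (P : List (List ℤ)) : Bool :=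
  decide (∀ i : Fin 12, (P.getD i []).length ≤ 12 ∧
    (mulMod 0 12 rem d (P.getD i [])).length ≤ 12 ∧
    ∀ k : Fin 12, (i < k → (P.getD i []).getD k 0 = 0) ∧
      (k < i → (mulMod 0 12 rem d (P.getD i [])).getD k 0 = 0))

end ListPoly

section
variable {K : Type*} [Field K] [NumberField K] {c : List ℤ}

omit [NumberField K] in
lemma norm_eq_of_normCert [CharZero K] {rem d : List ℤ} {P : List (List ℤ)}
    (hcert : ListPoly.normCert rem d P = true) {θ : K} (B : Module.Basis (Fin 12) ℚ K)
    (hB : ∀ i, B i = θ ^ (i : ℕ)) (hθ : θ ^ 12 = ListPoly.eval θ rem) :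
    Algebra.norm ℚ (ListPoly.eval θ d) * ((∏ i : Fin 12, (P.getD i []).getD i 0 : ℤ) : ℚ) =
      ((∏ i : Fin 12, (ListPoly.mulMod 0 12 rem d (P.getD i [])).getD i 0 : ℤ) : ℚ) := by
  rw [ListPoly.normCert, decide_eq_true_iff] at hcert
  have key := norm_mul_prod_eq B (ListPoly.eval θ d)
    (fun i k => (((P.getD i []).getD k 0 : ℤ) : ℚ))
    (fun i k => (((ListPoly.mulMod 0 12 rem d (P.getD i [])).getD k 0 : ℤ) : ℚ))
    (fun i k h => by simp only [((hcert i).2.2 k).1 h, Int.cast_zero])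
    (fun i k h => by simp only [((hcert i).2.2 k).2 h, Int.cast_zero]) ?_
  · push_cast at key ⊢
    exact key
  intro i
  obtain ⟨hPl, hTl, -⟩ := hcert i
  have h1 := ListPoly.eval_mulMod Int.cast_zero hθ d (P.getD i [])
  rw [ListPoly.eval_eq_sum θ hPl, ListPoly.eval_eq_sum θ hTl] at h1
  simpa only [hB, Algebra.smul_def, eq_ratCast, Rat.cast_intCast] using h1.symm

lemma aeval_toPoly_append_one {R : Type*} [CommRing R] {θ : R} (hc : c.length = 12)
    (hθ : ListPoly.eval θ (c ++ [1]) = 0) :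
    θ ^ 12 = ListPoly.eval θ (ListPoly.scale (-1) c) := by
  rw [ListPoly.eval_append_one, hc] at hθ
  rw [ListPoly.eval_scale]
  push_cast
  linear_combination hθ

/-- The discriminant of the powers of a generator of a field of degree twelve. -/
lemma discr_pow_eq_norm (hK : Module.finrank ℚ K = 12) (hc : c.length = 12)
    (hirr : Irreducible ((ListPoly.toPoly (c ++ [1])).map (Int.castRingHom ℚ))) {θ : K}
    (hθ : ListPoly.eval θ (c ++ [1]) = 0) :
    ∃ B : Module.Basis (Fin 12) ℚ K, (∀ i, B i = θ ^ (i : ℕ)) ∧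
      Algebra.discr ℚ (fun i : Fin 12 => θ ^ (i : ℕ)) =
        Algebra.norm ℚ (ListPoly.eval θ (ListPoly.deriv (c ++ [1]))) := by
  obtain ⟨hm, hd⟩ := toPoly_append_one c (by rintro rfl; simp at hc)
  have hint : IsIntegral ℚ θ := Algebra.IsIntegral.isIntegral θ
  have hmin : minpoly ℚ θ = (ListPoly.toPoly (c ++ [1])).map (Int.castRingHom ℚ) := by
    refine (minpoly.eq_of_irreducible_of_monic hirr ?_ (hm.map _)).symm
    rw [← algebraMap_int_eq, aeval_map_algebraMap, ← ListPoly.eval_eq_aeval, hθ]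
  have hdeg : (minpoly ℚ θ).natDegree = 12 := by rw [hmin, hm.natDegree_map, hd, hc]
  have htop : Algebra.adjoin ℚ {θ} = ⊤ := by
    have := (Field.primitive_element_iff_minpoly_natDegree_eq ℚ θ).mpr (hdeg.trans hK.symm)
    rw [← IntermediateField.adjoin_simple_toSubalgebra_of_isAlgebraic hint.isAlgebraic, this]
    rfl
  let pb := PowerBasis.ofAdjoinEqTop hint htop
  have hdim : pb.dim = 12 := hdeg
  have hgen : pb.gen = θ := rfl
  refine ⟨pb.basis.reindex (finCongr hdim), fun i => by simp [hgen], ?_⟩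
  have h1 := Algebra.discr_powerBasis_eq_norm ℚ pb
  have h2 := Algebra.discr_reindex ℚ pb.basis (finCongr hdim)
  have h3 : pb.basis ∘ (finCongr hdim).symm = fun i : Fin 12 => θ ^ (i : ℕ) := by
    funext i; simp [hgen]
  rw [h3, h1, hK, hgen, hmin, derivative_map, ListPoly.derivative_toPoly, ← algebraMap_int_eq,
    aeval_map_algebraMap, ← ListPoly.eval_eq_aeval] at h2
  rw [h2]
  -- The sign is $(-1)^{12\cdot 11/2}=1$.
  norm_num

omit [NumberField K] in
/-- The conclusion that Dedekind's criterion draws about the index of a generator. -/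
lemma not_dvd_index {h : ℤ[X]} (hm : h.Monic) {n : ℕ} (hn : h.natDegree = n) {θ : 𝓞 K} {j : ℤ}
    {p : ℕ} [Fact p.Prime]
    (hj : (p : ℤ) ∣ j → ∃ v : Fin n → ℤ, (∃ i, ¬ (p : ℤ) ∣ v i) ∧
        (p : 𝓞 K) ∣ ∑ i, v i * θ ^ (i : ℕ))
    (hdvd : ∀ y : ℤ[X], (p : 𝓞 K) ∣ aeval θ y →
      h.map (Int.castRingHom (ZMod p)) ∣ y.map (Int.castRingHom (ZMod p))) : ¬ (p : ℤ) ∣ j := by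
  intro hpj
  obtain ⟨v, ⟨i, hi⟩, hv⟩ := hj hpj
  have h1 := hdvd (∑ i : Fin n, C (v i) * X ^ (i : ℕ)) (by simpa using hv)
  have h2 : (∑ i : Fin n, C (v i) * X ^ (i : ℕ)).map (Int.castRingHom (ZMod p)) = 0 := by
    -- A combination of the first `n` powers has degree below that of `h`, so divisibility forces it
    -- to vanish modulo `p`.
    refine eq_zero_of_dvd_of_degree_lt h1 ?_
    rw [degree_eq_natDegree (hm.map _).ne_zero, hm.natDegree_map, hn]
    refine degree_map_le.trans_lt ?_
    exact degree_sum_fin_lt v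
  have h3 := congrArg (fun q => coeff q (i : ℕ)) h2
  simp only [coeff_map, finsetSum_coeff, coeff_C_mul, coeff_X_pow, coeff_zero] at h3
  apply hi
  rw [← ZMod.intCast_zmod_eq_zero_iff_dvd]
  simpa [Fin.val_inj] using h3

end

namespace ListPoly

def pow (a : List ℤ) : ℕ → List ℤ
  | 0 => [1]
  | n + 1 => mul a (pow a n)

lemma eval_pow {R : Type*} [CommRing R] (θ : R) (a : List ℤ) (n : ℕ) :
    eval θ (pow a n) = eval θ a ^ n := by
  induction n with
  | zero => simp [pow]
  | succ n ih => rw [pow, eval_mul, ih, pow_succ']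

/-- Whether `uv` is a Bézout relation for `a` and `b` modulo `p`. -/
def bezoutCert (p : ℕ) (a b : List ℤ) (uv : List ℤ × List ℤ) : Bool :=
  eqMod p (add (mul uv.1 a) (mul uv.2 b)) [1]

/-- A factorization modulo `p` to which Dedekind's criterion applies. -/
def dedekindCert (p : ℕ) (l : List ℤ) (φ₁ : List ℤ) (e₁ : ℕ) (φ₂ : List ℤ) (e₂ : ℕ) (F : List ℤ)
    (s₁ s₂ t t₁ t₂ : List ℤ × List ℤ) : Bool :=
  eqMod 0 l (add (mul (pow φ₁ e₁) (pow φ₂ e₂)) (scale p F)) &&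
  bezoutCert p φ₁ (deriv φ₁) s₁ && bezoutCert p φ₂ (deriv φ₂) s₂ && bezoutCert p φ₁ φ₂ t &&
  (decide (e₁ < 2) || bezoutCert p φ₁ F t₁) && (decide (e₂ < 2) || bezoutCert p φ₂ F t₂)

/-- For an element `b` with `q * b = u`, the coefficients of `q ^ l.length` times the value at `b`
of the polynomial with coefficients `l`. -/
def scaledComp (rem : List ℤ) (q : ℤ) (u : List ℤ) : List ℤ → List ℤ
  | [] => []
  | c :: l => add [c * q ^ (l.length + 1)] (mulMod 0 12 rem u (scaledComp rem q u l))

lemma eval_scaledComp {R : Type*} [CommRing R] {rem : List ℤ} {θ b : R} {q : ℤ} {u : List ℤ}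
    (hθ : θ ^ 12 = eval θ rem) (hb : q * b = eval θ u) (l : List ℤ) :
    eval θ (scaledComp rem q u l) = q ^ l.length * eval b l := by
  induction l with
  | nil => simp [scaledComp]
  | cons c l ih =>
    rw [scaledComp, eval_add, eval_mulMod Int.cast_zero hθ, ih, eval_cons, eval_cons, eval_nil,
      List.length_cons, ← hb]
    push_cast
    ring

lemma not_dvd_index_of_dedekindCert {K : Type*} [Field K] [NumberField K] {c : List ℤ}
    (hc : c.length = 12)
    (hirr : Irreducible ((toPoly (c ++ [1])).map (Int.castRingHom ℚ))) {θ : 𝓞 K}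
    (hθ : eval θ (c ++ [1]) = 0) {j : ℤ} {p : ℕ} [Fact p.Prime]
    (hj : (p : ℤ) ∣ j → ∃ v : Fin 12 → ℤ, (∃ i, ¬ (p : ℤ) ∣ v i) ∧
        (p : 𝓞 K) ∣ ∑ i, v i * θ ^ (i : ℕ))
    {φ₁ φ₂ F : List ℤ} {e₁ e₂ : ℕ} {s₁ s₂ t t₁ t₂ : List ℤ × List ℤ}
    (hcert : dedekindCert p (c ++ [1]) φ₁ e₁ φ₂ e₂ F s₁ s₂ t t₁ t₂ = true) : ¬ (p : ℤ) ∣ j := by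
  obtain ⟨hm, hd⟩ := toPoly_append_one c (by rintro rfl; simp at hc)
  simp only [dedekindCert, Bool.and_eq_true, Bool.or_eq_true, decide_eq_true_iff] at hcert
  obtain ⟨⟨⟨⟨⟨hfac, hs₁⟩, hs₂⟩, ht⟩, ht₁⟩, ht₂⟩ := hcert
  have hθ' : aeval θ (toPoly (c ++ [1])) = 0 := by rw [← eval_eq_aeval, hθ]
  have hfac1 : toPoly (c ++ [1]) =
      toPoly φ₁ ^ e₁ * toPoly φ₂ ^ e₂ + C (p : ℤ) * toPoly F := by
    have := eval_eq_of_eqMod (X : ℤ[X]) Int.cast_zero hfac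
    rw [eval_add, eval_mul, eval_pow, eval_pow, eval_scale] at this
    simpa only [toPoly_eq_eval, eq_intCast] using this
  have hfac2 : toPoly (c ++ [1]) =
      toPoly φ₂ ^ e₂ * toPoly φ₁ ^ e₁ + C (p : ℤ) * toPoly F := by rw [hfac1]; ring
  have hcop := isCoprime_of_bezout φ₁ φ₂ t.1 t.2 ht
  have hsq₁ := squarefree_of_bezout φ₁ s₁.1 s₁.2 hs₁
  have hsq₂ := squarefree_of_bezout φ₂ s₂.1 s₂.2 hs₂
  refine not_dvd_index hm (hd.trans hc) hj fun y hy => ?_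
  have h1 := pow_dvd_of_dvd_aeval hm hirr hθ' hfac1 hsq₁
    (by rw [Polynomial.map_pow]; exact hcop.pow_right)
    (fun he => isCoprime_of_bezout _ _ t₁.1 t₁.2 (ht₁.resolve_left (by omega))) hy
  have h2 := pow_dvd_of_dvd_aeval hm hirr hθ' hfac2 hsq₂
    (by rw [Polynomial.map_pow]; exact hcop.symm.pow_right)
    (fun he => isCoprime_of_bezout _ _ t₂.1 t₂.2 (ht₂.resolve_left (by omega))) hy
  have hC : (C (p : ℤ)).map (Int.castRingHom (ZMod p)) = 0 := by simp
  rw [hfac1, Polynomial.map_add, Polynomial.map_mul, Polynomial.map_mul, Polynomial.map_pow,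
    Polynomial.map_pow, hC, zero_mul, add_zero]
  exact hcop.pow.mul_dvd h1 h2

end ListPoly

/-- The powers of a generator have discriminant `j ^ 2 * discr K`, where `j` is their index. -/
lemma exists_index_of_normCert {K : Type*} [Field K] [NumberField K]
    (hK : Module.finrank ℚ K = 12) {c : List ℤ} (hc : c.length = 12)
    (hirr : Irreducible ((ListPoly.toPoly (c ++ [1])).map (Int.castRingHom ℚ))) {θ : K}
    (hθ : ListPoly.eval θ (c ++ [1]) = 0) {P : List (List ℤ)}
    (hcert : ListPoly.normCert (ListPoly.scale (-1) c) (ListPoly.deriv (c ++ [1])) P = true)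
    {N : ℤ} (hP : ∏ i : Fin 12, (P.getD i []).getD i 0 ≠ 0)
    (hN : N * ∏ i : Fin 12, (P.getD i []).getD i 0 = ∏ i : Fin 12, (ListPoly.mulMod 0 12
      (ListPoly.scale (-1) c) (ListPoly.deriv (c ++ [1])) (P.getD i [])).getD i 0) :
    ∃ (t : 𝓞 K) (j : ℤ), (t : K) = θ ∧ ListPoly.eval t (c ++ [1]) = 0 ∧ N = j ^ 2 * discr K ∧
      ∀ p : ℕ, p.Prime → (p : ℤ) ∣ j → ∃ v : Fin 12 → ℤ, (∃ i, ¬ (p : ℤ) ∣ v i) ∧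
        (p : 𝓞 K) ∣ ∑ i, v i * t ^ (i : ℕ) := by
  obtain ⟨hm, hd⟩ := toPoly_append_one c (by rintro rfl; simp at hc)
  have hint : IsIntegral ℤ θ := ⟨_, hm, by
    rw [← aeval_def, ← ListPoly.eval_eq_aeval]; exact hθ⟩
  obtain ⟨B, hB, hdisc⟩ := discr_pow_eq_norm hK hc hirr hθ
  have hnorm := norm_eq_of_normCert hcert B hB (aeval_toPoly_append_one hc hθ)
  obtain ⟨j, hj, hjp⟩ := exists_index hK (⟨θ, hint⟩ : 𝓞 K)
  refine ⟨⟨θ, hint⟩, j, rfl, RingOfIntegers.ext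
    (((ListPoly.map_eval (algebraMap (𝓞 K) K) ⟨θ, hint⟩ _).trans hθ).trans
      (map_zero (algebraMap (𝓞 K) K)).symm), ?_, hjp⟩
  have hj : Algebra.discr ℚ (fun i : Fin 12 => θ ^ (i : ℕ)) = j ^ 2 * discr K := hj
  rw [← hN, ← hdisc, hj, Int.cast_mul] at hnorm
  have := mul_right_cancel₀ (Int.cast_ne_zero.mpr hP) hnorm
  exact_mod_cast this.symm

/-! ### The discriminant of a root field -/

/-- The coefficients, except the leading one, of the minimal polynomial of `b`, an element
of a root field of `g₀` whose index is prime to the discriminant. -/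
def auxCoeffs : List ℤ :=
  [-324536311, -135120354, 293029011, 221634908, 20192887, -18743010, -4050893, 293282, 127545,
   5544, -539, -22]

/-- The coordinates of a multiple of the element `b` in the powers of a root of `g₀`. -/
def auxElement : List ℤ :=
  [33083491336111936, -34245623809065856, -138939018946781680, -54747067034546208,
   31760285387144448, 18180607510538344, -968726470258252, -1336657787345956, -30171310675162,
   31253789126308, 816080453447, -149248550537]

/-- The denominator of `b`. -/
def auxDenominator : ℤ := 801120417439936

/-- Triangularizes the multiplication by the derivative of `g₀` at a root. -/
def g0Triangular : List (List ℤ) :=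
  [[1], [-10179, 3884], [-16442478, -1587745, 23585099], [1627274229282, -4162035137161,
   -719263041277, 99496595296], [3063868901305524, 6480954151820500, -39089591467806398,
   -5723617354052878, 901121114466909], [-4851575244212281019136, 13829052323207845412436,
   479809978702031747956, -2113601861458643389358, -36626919902121126718, 12615116781923007429],
   [945698567138300221529084568, -5155200931112327940322771488, 6435854149906936774558534820,
   1882510265568367090545233756, -841034461436018559074933576, -48808443045844734920515578,
   6143289009989579311395897], [62227597181154804259463111184, -318003263432706287374090686104,
   358025591011287274839922781320, 135028936191424569719438009908, -43113859116140636199161514788,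
   -4773501746629184888157662444, 254974279538317329181276836, 12472493200449548772155855],
   [-1183407494340708810202000948704, 6468630934649354958502153197296,
   -8024360390711162980718292423464, -3033756357829892798492676305336,
   2225881681554424243481157687748, 338564540888941443301609185220,
   -106062774609726712967356110304, -5097908083458191105017851872, 634726058647417843199791771],
   [-7870461740100371029088953082016, 41651593121536582225679717608064,
   -46009535646430315745271633604320, -29096184515324723195939269606376,
   11433261616485102498716209357288, 4405518503485953817339171702780,
   -387955496411356003872557874328, -126275953428236079551148023932, -219712142245996297379000992,
   544091898145812465548903063], [48133323072760416019488657213984,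
   -256756761265783910290708281935296, 288080995150052309401000053333360,
   187763328302902105190055131582032, -103700332599190968132600374246168,
   -33925922438575868714705152602152, 9853685298552339954984099752672,
   1607504791151961367128655081652, -303346518495914815765818168844,
   -16468447425975137007384084910, 1743235686261595355720198619],
   [31323882367670017049368070110848, -155037002750872130072837722026784,
   123227783798969811396936812870528, 194170623790467258542666387039504,
   -20702614840066629547537597225104, -47232988317098428702363222235336,
   -1914960095866963702443019539592, 3333484633041892025586946722768,
   185022055680454995879124905020, -79342393432197975419990621180, -2673053113858224582091651090,
   394552920574952230031680337]]

/-- Triangularizes the multiplication by the derivative of the minimal polynomial of `b` at `b`. -/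
def auxTriangular : List (List ℤ) :=
  [[1], [649072622, 22520059], [-122207286497713681, -38728932901442247, 18812105398621065],
   [399267946302615920786279562, -204487908548129636053827491, -78036995935968604819841787,
   2776506789657715850481477], [1745613123540987316080035278034489283,
   -86520041644606194705534966789785503, -1293853580748677813896543759309736031,
   -172683210948508488114606957570175695, 10137241601145523978633356832730853],
   [-23808855887470653755848129530247804156669010504,
   16090160980750000454901466988291048023499125341,
   10676713164370466778099101997206222966278775799,
   -1344434837074908181918112062931750765768930313,
   -186974346727480421105911625226161226355700473, 8358635749659517122959463428178024694760531],
   [-6997724662239348702363940779080079621406094194332342443,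
   -12153624835277498715756831948969615282491094015843139185,
   14780313316252904196982817208284560909490484359649600543,
   7066794633819810442362987591782611916029712605180765857,
   -1066063037511230364583016182884547227027319709727106963,
   -130886454546521801614230591308389050143168853761863951,
   6057597454577316131802037288775434286360599339329819],
   [7598003709742139490908060448535087783096745051423289994956470960,
   -4139835355836420931412647266155224086605611361004361476831924357,
   -4401336134533262492507266246613702760071290762959537546240784255,
   148600344488419270324117060699664821890390006455129985012948817,
   209046315686491559503151497162779060513945915001060623847681423,
   1844215509130473928815035325032267281163383748765388462313603,
   -1035379653696376776274844354674380786054498559436478410815649,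
   24729117380368428263297817589173970671906702693628799618341],
   [65802827026057816204936677254674161166335908114345343270990295607567221,
   -12793376770710290660288225720168961054801375916159853050934415465772669,
   -51972176930394764805527199504327988036398655716796201391081405839432088,
   -11204458150547107348257697713937412282799083390082128516137925109237740,
   2843416254790752342783593406344910544865634012741779917169831844772728,
   579854582904613052310072217999643437095619285599527804986546256466966,
   -13806489477422754646780926640192088371542360755956045942202015228292,
   -2515857377444018964129070011208626416245057280876024960416003665135,
   76892496647482045867064571717760665054228525062191224220703674807],
   [479224680942424003003516184945938404945925858442657841686830593104695771678873,
   -88572694742557724332535706704454644725749154699912948354182200751322945187011,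
   -379870617433196519497179529613069580240147965938115077038267143424077384940521,
   -84944225368877122832215611192127260692050446283743667454722300049612747980853,
   20183286463381312843637251445833959073483343730523425154464994313386161478647,
   4400252386323963512608427619616400568106746708336292457877476973748527131223,
   -71693667712624450420242086756878461567588294927893001349748124638393302923,
   -19186984240121710290443927053573441590146826222031540265266251230722314378,
   440654056196255785702434237591518155517265942473167535426934863786395660,
   3782601829341262723498824973958607649100808809626921057569813000489882],
   [-6920466266534253918635036469853926667048269023339714151378575628685805544244879757672,
   1602383622387439292537048426310294270734012295322377932809608316311755679665392120079,
   5785731578037514107782490057673553728300304107844779893041480735669436477631796439619,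
   863126012080758684660436374064427151010913315794477836251925752121305917336499298517,
   -610519061882658944284099493757138374632928931815739248666376715011514551439888713183,
   -90973146311337026268329643003811386055847503580674679971560113565674132339886101547,
   17879078168870847106154667623261321390491366042931405352377672490707376424772822397,
   2486565274006067362232293247527607468316991413279813102718211631500663800984903767,
   -86965021268893413366549613171855328696092957523045908912821753694326627585431690,
   -9094885063043644839217565945380369498591189849768976332597404692207735521423248,
   298530376588077712554957996718248147206114983029543043281049652204321999327550],
   [-7349764697197630438954700303830009565945302096018693803300056288049183597309710265159988,
   -828624781196967949336229595879028192706814387655571500865393268783638176892492704079032,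
   6716318593552619593704891728207725542448401247985911986461432626332720116229964678345359,
   3018977193693439512759987512903463840033819865404998855201922212995050888638229351471873,
   -316809025073759599297923986158713146727110887240520630669262988154466875361587581431589,
   -305816618245310806101075997896754621033667160941137164155391439550462928809557187148041,
   -13069125724343049660108816193049579682455839430204451487523708185051569646094060316513,
   8437411045629260247297748877358507860584582676601819847925789908602252083296924767083,
   719665246223071337661825692629976732761406343790717499921380064290060225174357062505,
   -37912480663384122607991370287122781843800023760510749318604804005378600079221181428,
   -2610855274168809671432682316496914086437772387772819076407061075133435267147724940,
   96026642924974810411104454502024276199352695879298617069471962243566555423802854]]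

lemma aux_irreducible :
    Irreducible ((ListPoly.toPoly (auxCoeffs ++ [1])).map (Int.castRingHom ℚ)) := by
  have : Fact (Nat.Prime 5) := ⟨by norm_num⟩
  obtain ⟨hm, hd⟩ := toPoly_append_one auxCoeffs (by simp [auxCoeffs])
  refine irreducible_of_periodCert (p := 5) (n := 12) (rem := ListPoly.scale (-1) auxCoeffs)
    (us := [(6, [0, 1, 1, 3, 1, 2, 1, 2, 2, 0, 3, 3]), (4, [4, 0, 0, 4, 4, 1, 3, 4, 3, 0, 4, 4])])
    (by norm_num) hm hd (fun k _ θ h => aeval_toPoly_append_one rfl h)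
    (by decide +kernel) ?_
  intro q hq h
  rcases prime_dvd_twelve hq h with rfl | rfl <;> simp

/-- Two generators with coprime cofactors determine the discriminant. -/
lemma eq_of_sq_mul_eq {D d i₁ i₂ j₁ j₂ : ℤ} (h₁ : D * i₁ ^ 2 = j₁ ^ 2 * d)
    (h₂ : D * i₂ ^ 2 = j₂ ^ 2 * d) (hD : D ≠ 0) (hi₁ : i₁ ≠ 0) (hcop : IsCoprime i₁ i₂)
    (hj : ∀ p : ℕ, p.Prime → (p : ℤ) ∣ D → ¬ (p : ℤ) ∣ j₁) : d = D := by
  have hd : d ≠ 0 := by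
    rintro rfl
    exact (mul_ne_zero hD (pow_ne_zero 2 hi₁)) (by rw [h₁, mul_zero])
  -- Eliminating `D` and `d` leaves an equality of squares, from which coprimality yields `i₁ ∣ j₁`.
  have hsq : (j₁ * i₂) ^ 2 = (j₂ * i₁) ^ 2 := by
    refine mul_right_cancel₀ (mul_ne_zero hd hD) ?_
    linear_combination (-D * i₂ ^ 2) * h₁ + (D * i₁ ^ 2) * h₂
  have hdvd : i₁ ∣ j₁ := by
    refine hcop.dvd_of_dvd_mul_right ?_
    rcases sq_eq_sq_iff_eq_or_eq_neg.mp hsq with h | h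
    · exact h ▸ dvd_mul_left _ _
    · exact h ▸ (dvd_mul_left _ _).neg_right
  obtain ⟨e, rfl⟩ := hdvd
  have hDe : D = e ^ 2 * d := by
    refine mul_right_cancel₀ (pow_ne_zero 2 hi₁) ?_
    linear_combination h₁
  -- Now `D = e ^ 2 * d`, so a prime factor of `e` would divide both `D` and `j₁`, which is
  -- excluded.
  have hunit : IsUnit e := by
    rw [Int.isUnit_iff_natAbs_eq]
    by_contra hne
    obtain ⟨p, hp, hpe⟩ := Nat.exists_prime_and_dvd hne
    have hpe : (p : ℤ) ∣ e := Int.natCast_dvd.mpr hpe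
    exact hj p hp (hDe ▸ (hpe.trans (dvd_pow_self e two_ne_zero)).mul_right d)
      (hpe.mul_left i₁)
  rcases Int.isUnit_iff.mp hunit with rfl | rfl <;> simpa using hDe.symm

lemma finrank_eq_twelve {K : Type*} [Field K] [NumberField K] {a : K} (ha : aeval a g₀ = 0)
    (htop : IntermediateField.adjoin ℚ {a} = ⊤) : Module.finrank ℚ K = 12 := by
  have hm : g₀.Monic := by rw [← g0Int_map]; exact g0Int_monic.map _
  have hmin := minpoly.eq_of_irreducible_of_monic g0_irreducible ha hm
  rw [← (Field.primitive_element_iff_minpoly_natDegree_eq ℚ a).mp htop, ← hmin, ← g0Int_map,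
    g0Int_monic.natDegree_map, g0Int_natDegree]

/-- The discriminant of the root fields of `g₀`. -/
theorem discr_root_field {K : Type*} [Field K] [NumberField K] {a : K} (ha : aeval a g₀ = 0)
    (htop : IntermediateField.adjoin ℚ {a} = ⊤) :
    discr K = 2 ^ 18 * 3 ^ 5 * 11 ^ 13 * 41 ^ 6 := by
  have hK := finrank_eq_twelve ha htop
  have hirr : Irreducible ((ListPoly.toPoly (g0Coeffs.dropLast ++ [1])).map
      (Int.castRingHom ℚ)) := by
    have := g0_irreducible
    rwa [← g0Int_map] at this
  have ha0 : ListPoly.eval a (g0Coeffs.dropLast ++ [1]) = 0 := eval_eq_zero_of_aeval_g0 ha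
  -- For the root of `g₀` only the size of the discriminant is kept; its index is not examined at
  -- any prime.
  obtain ⟨-, j₂, -, -, hj₂, -⟩ := exists_index_of_normCert hK rfl hirr ha0 (P := g0Triangular)
    (N := 2 ^ 18 * 3 ^ 5 * 11 ^ 13 * 41 ^ 6 * 12594136931106624579750068224 ^ 2)
    (by decide +kernel) (by decide +kernel) (by decide +kernel)
  have hq : (auxDenominator : K) ≠ 0 := by
    rw [auxDenominator]; exact Int.cast_ne_zero.mpr (by norm_num)
  obtain ⟨b, hb⟩ : ∃ b : K, auxDenominator * b = ListPoly.eval a auxElement :=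
    ⟨(auxDenominator : K)⁻¹ * ListPoly.eval a auxElement, mul_inv_cancel_left₀ hq _⟩
  -- Clearing the denominator turns the equation for `b` into an exact identity of integer
  -- polynomials modulo `g₀`.
  have hb0 : ListPoly.eval b (auxCoeffs ++ [1]) = 0 := by
    have h1 := ListPoly.eval_scaledComp (aeval_toPoly_append_one rfl ha0) hb (auxCoeffs ++ [1])
    have h2 : ListPoly.eqMod 0 (ListPoly.scaledComp (ListPoly.scale (-1) g0Coeffs.dropLast)
      auxDenominator auxElement (auxCoeffs ++ [1])) [] = true := by decide +kernel
    rw [ListPoly.eval_eq_of_eqMod a Int.cast_zero h2] at h1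
    exact (mul_eq_zero.mp h1.symm).resolve_left (pow_ne_zero _ hq)
  obtain ⟨t, j₁, -, ht, hj₁, hindex⟩ := exists_index_of_normCert hK rfl aux_irreducible hb0
    (P := auxTriangular)
    (N := 2 ^ 18 * 3 ^ 5 * 11 ^ 13 * 41 ^ 6 * 9934477577110847189917449658790557293008543 ^ 2)
    (by decide +kernel) (by decide +kernel) (by decide +kernel)
  refine eq_of_sq_mul_eq hj₁ hj₂ (by norm_num) (by norm_num)
    (Int.isCoprime_iff_gcd_eq_one.mpr (by decide +kernel)) ?_
  intro p hp hpD
  have hp4 : p = 2 ∨ p = 3 ∨ p = 11 ∨ p = 41 := by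
    have h1 : p ∣ 2 ^ 18 * 3 ^ 5 * 11 ^ 13 * 41 ^ 6 := by exact_mod_cast hpD
    rcases hp.dvd_mul.mp h1 with h1 | h1
    · rcases hp.dvd_mul.mp h1 with h1 | h1
      · rcases hp.dvd_mul.mp h1 with h1 | h1
        · exact Or.inl ((Nat.prime_dvd_prime_iff_eq hp (by norm_num)).mp (hp.dvd_of_dvd_pow h1))
        · exact Or.inr (Or.inl
            ((Nat.prime_dvd_prime_iff_eq hp (by norm_num)).mp (hp.dvd_of_dvd_pow h1)))
      · exact Or.inr (Or.inr (Or.inl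
          ((Nat.prime_dvd_prime_iff_eq hp (by norm_num)).mp (hp.dvd_of_dvd_pow h1))))
    · exact Or.inr (Or.inr (Or.inr
        ((Nat.prime_dvd_prime_iff_eq hp (by norm_num)).mp (hp.dvd_of_dvd_pow h1))))
  have := Fact.mk hp
  have hjp := hindex p hp
  -- Modulo 2 and 41 the auxiliary polynomial is the square of a squarefree sextic, modulo 3 it is
  -- the square of a quintic times `X ^ 2 - 1`, and modulo 11 it is `(X + 5) ^ 11 * X`.
  rcases hp4 with rfl | rfl | rfl | rfl
  · exact ListPoly.not_dvd_index_of_dedekindCert rfl aux_irreducible ht hjp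
      (φ₁ := [1, 1, 1, 1, 1, 1, 1]) (e₁ := 2) (φ₂ := [1]) (e₂ := 1) (F := [-162268156, -67560178,
        146514504, 110817452, 10096441, -9371508, -2025450, 146638, 63770, 2770, -271, -12]) (s₁
        := ([1], [0, 1, 1])) (s₂ := ([1], [])) (t := ([], [1])) (t₁ := ([1, 1, 0, 0, 1, 1, 1, 0,
        1, 1], [1, 0, 1, 0, 0, 1])) (t₂ := ([], []))
      (by decide +kernel)
  · exact ListPoly.not_dvd_index_of_dedekindCert rfl aux_irreducible ht hjp
      (φ₁ := [1, 0, -1, -1, 1, 1]) (e₁ := 2) (φ₂ := [-1, 0, 1]) (e₂ := 1) (F := [-108178770,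
        -45040118, 97676336, 73878302, 6730964, -6247668, -1350299, 97758, 42515, 1850, -179, -8])
        (s₁ := ([1, 0, 1, 1], [0, 0, 0, 0, 1])) (s₂ := ([-1], [0, -1])) (t := ([1], [0, 0, -1,
        -1])) (t₁ := ([1, 1, -1, -1, 0, 0, 1, -1, 0, 1, 1], [-1, 1, 0, -1, -1])) (t₂ := ([], []))
      (by decide +kernel)
  · exact ListPoly.not_dvd_index_of_dedekindCert rfl aux_irreducible ht hjp
      (φ₁ := [5, 1]) (e₁ := 11) (φ₂ := [0, 1]) (e₂ := 1) (F := [-29503301, -16722589, 16873376,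
        10383003, -4023658, -4047660, -1024513, -104588, -7155, -1371, -174, -7]) (s₁ := ([],
        [1])) (s₂ := ([], [1])) (t := ([-2], [2])) (t₁ := ([0, -1, -4, 4, 5, -4, -4, 3, 2, 5, 5],
        [-4])) (t₂ := ([], []))
      (by decide +kernel)
  · exact ListPoly.not_dvd_index_of_dedekindCert rfl aux_irreducible ht hjp
      (φ₁ := [3, 11, -13, 3, -2, -11, 1]) (e₁ := 2) (φ₂ := [1]) (e₂ := 1) (F := [-7915520,
        -3295620, 7147048, 5405736, 492504, -457142, -98798, 7146, 3113, 134, -16]) (s₁ := ([-2,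
        -18, -10, -10, 13], [-18, -17, 19, -7, -16, -9])) (s₂ := ([1], [])) (t := ([], [1])) (t₁
        := ([13, -20, -2, -14, 17, -8, 8, 19, 20, -6], [2, -2, 19, -4, 8, 15])) (t₂ := ([], []))
      (by decide +kernel)

theorem lemma13 :
    -- a root field is an extension of degree 12
    Irreducible g₀ ∧
    -- the Galois group over the rationals is the projective general linear group
    Nonempty (g₀.Gal ≃* Matrix.ProjGenLinGroup (Fin 2) (ZMod 11)) ∧
    -- the splitting field inside the complex numbers is contained in the real numbers
    (∀ z ∈ IntermediateField.adjoin ℚ (g₀.rootSet ℂ), ∃ r : ℝ, (r : ℂ) = z) ∧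
    -- every number field generated by one root of the polynomial has the given discriminant
    (∀ (K : Type*) [Field K] [NumberField K] (a : K), aeval a g₀ = 0 →
      IntermediateField.adjoin ℚ {a} = ⊤ →
      NumberField.discr K = 2 ^ 18 * 3 ^ 5 * 11 ^ 13 * 41 ^ 6) := by
  exact ⟨g0_irreducible, nonempty_galois_mulEquiv, splitting_field_real,
    fun _ _ _ _ ha htop => discr_root_field ha htop⟩
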